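/- Let $V:\mathbb R\to\mathbb R$ be a $C^2$, $2\pi$-periodic potential with $V(\pi)=0$, $V(x)<0$ for all $x\notin\pi+2\pi\mathbb Z$, and $V''(\pi)<0$, and suppose that $V''$ is Lipschitz at $\pi$, i.e. $V''(x)-V''(\pi)=O(|x-\pi|)$ as $x\to\pi$ (for example, $V\in C^3$). Put $\lambda=\sqrt{-V''(\pi)}$, let $\kappa\in\mathbb R$ satisfy $2\kappa+V''(\pi)=2\kappa-\lambda^2>0$, and define $\omega>0$ by $\omega^2=2\kappa+V''(\pi)=2\kappa-\lambda^2$. For $E>0$ let $p(t;E)$ be the solution of $\ddot p+V'(p)=0$ with energy $\dot p^2/2+V(p)=E$, $p(0;E)=0$ and $\dot p(0;E)>0$; let $T(E)=\frac1{\sqrt2}\int_{-\pi}^{\pi}\frac{dx}{\sqrt{E-V(x)}}$ be the time in which $p$ advances by $2\pi$, and let $F_E$ be the Floquet matrix of $\ddot w+(2\kappa+V''(p(t;E)))w=0$, that is, the matrix that advances $(w,\dot w)$ from time $-T(E)/2$ to time $T(E)/2$. This matrix exists and is unique for every $E>0$. Then there are constants $a\ge 2$ and $\varphi$, depending only on $V$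 and $\kappa$, such that $$\mathrm{tr}\,F_E=a\cos\Big(\frac{\omega}{\lambda}\ln E-\varphi\Big)+o(1)\qquad\text{as }E\downarrow0 .$$ Consequently the spectrum of $F_E$ is asymptotically periodic in $\ln E$ with period $2\pi\lambda/\omega$: the Hausdorff distance in $\mathbb C$ between the set of eigenvalues of $F_E$ and the set of eigenvalues of $F_{e^{2\pi\lambda/\omega}E}$ tends to $0$ as $E\downarrow0$. -/

import Mathlib

open Real Set Filter Topology Asymptotics

/-- The class of potentials: `V` is `C²` and `2π`-periodic, its global maximum value `0` is attained
exactly at the points `π + 2πn`, the maximum is nondegenerate (`V''(π) < 0`), and `V''` is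
Lipschitz at the point `π`, i.e. `V''(x) - V''(π) = O(x - π)` as `x → π`. -/
structure IsAdmissiblePotential (V : ℝ → ℝ) : Prop where
  contDiff : ContDiff ℝ 2 V
  periodic : Function.Periodic V (2 * π)
  max_eq_zero : V π = 0
  neg_elsewhere : ∀ x : ℝ, (∀ n : ℤ, x ≠ π + 2 * π * n) → V x < 0
  nondegenerate : deriv (deriv V) π < 0
  lipschitz_at_max :
    (fun x => deriv (deriv V) x - deriv (deriv V) π) =O[𝓝 π] (fun x => x - π)

/-- `p` is the rotating synchronous solution of energy `E`: it solves `p'' + V'(p) = 0`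
with `p'² / 2 + V(p) = E`, normalized by `p(0) = 0`, and rotates in the increasing direction. -/
structure IsSynchronousSolution (V : ℝ → ℝ) (E : ℝ) (p : ℝ → ℝ) : Prop where
  differentiable : Differentiable ℝ p
  ode : ∀ t : ℝ, HasDerivAt (deriv p) (-(deriv V (p t))) t
  energy : ∀ t : ℝ, (deriv p t) ^ 2 / 2 + V (p t) = E
  initial : p 0 = 0
  increasing : 0 < deriv p 0

/-- The period `T(E) = (1/√2) ∫_{-π}^{π} dx / √(E - V(x))`: the time in which the solution of
energy `E > 0` advances by `2π`. -/
noncomputable def rotationPeriod (V : ℝ → ℝ) (E : ℝ) : ℝ :=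
  1 / √2 * ∫ x in (-π)..π, 1 / √(E - V x)

/-- The coefficient matrix of `w' = u`, `u' = -(2κ + V''(p(t))) w`. -/
noncomputable def linearizedCoeff (V : ℝ → ℝ) (κ : ℝ) (p : ℝ → ℝ) (t : ℝ) :
    Matrix (Fin 2) (Fin 2) ℝ :=
  !![0, 1; -(2 * κ + deriv (deriv V) (p t)), 0]

/-- `M` is the advance matrix from time `s` to time `t` of the linear system `z' = L(r) z`:
`M = X(t)`, where `X` is the solution of `X' = L X` with `X(s) = I`. -/
def IsAdvanceMatrix (L : ℝ → Matrix (Fin 2) (Fin 2) ℝ) (s t : ℝ)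
    (M : Matrix (Fin 2) (Fin 2) ℝ) : Prop :=
  ∃ X : ℝ → Matrix (Fin 2) (Fin 2) ℝ,
    (∀ (r : ℝ) (i j : Fin 2), HasDerivAt (fun r' => X r' i j) ((L r * X r) i j) r) ∧
    X s = 1 ∧ X t = M

/-- `M` is the Floquet matrix `F_E` of `w'' + (2κ + V''(p(t; E))) w = 0`: the advance matrix of the
associated first order system over one period, from `-T(E)/2` to `T(E)/2`. -/
def IsFloquetMatrix (V : ℝ → ℝ) (κ E : ℝ) (M : Matrix (Fin 2) (Fin 2) ℝ) : Prop :=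
  ∃ p : ℝ → ℝ, IsSynchronousSolution V E p ∧
    IsAdvanceMatrix (linearizedCoeff V κ p) (-(rotationPeriod V E / 2)) (rotationPeriod V E / 2) M

/-- The set of complex eigenvalues of a real matrix. -/
def complexSpectrum (M : Matrix (Fin 2) (Fin 2) ℝ) : Set ℂ :=
  spectrum ℂ (M.map (algebraMap ℝ ℂ))

/-!
The idea is scattering. Near the separatrix the synchronous solution spends almost all of its period
close to the maximum of `V`, where the linearized equation is the free rotation
`w'' + ω² w = 0`; the quick passage from one maximum to the next acts as a fixed scattering map.

In the rotating frame, `exists_amplitudes`, the Floquet matrix is described by two complex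
amplitudes `a`, `c` with `‖a‖² - ‖c‖² = 1`, and its trace is `2 Re (exp (-i ω T(E)) a)`. Here the
period is cut at the passages through the maximum, which by periodicity of the coefficient only
conjugates the matrix. Taking the angle `x = p(t; E)` as the independent variable turns the amplitude equations
into linear equations on `[-π, π]`. Their coefficients involve
`(V''(x) - V''(π)) / √(E - V x)`, which is bounded uniformly in `E`
(`exists_abs_scatteringDensity_le`): at the maxima the numerator vanishes to first order by the
Lipschitz condition, and `√(-V)` vanishes exactly to first order by nondegeneracy. The coefficients
converge pointwise inside `(-π, π)`, hence are Cauchy in `L¹`, and Grönwall's inequality makes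
`a(π)` converge to a limit `α` with `‖α‖ ≥ 1` (`exists_tendsto_amplitude`).

Comparison with the quadratic potential shows that `T(E) + (log E) / lam` converges
(`exists_tendsto_rotationPeriod`). The trace is therefore asymptotic to a cosine in `log E` of
amplitude `2 ‖α‖ ≥ 2` (`exists_tendsto_trace_sub`). Since Floquet matrices have determinant `1`,
their spectrum depends on the trace alone, and does so `1/2`-Hölder continuously
(`hausdorffDist_complexSpectrum_le`); this yields the asymptotic periodicity of the spectrum.
-/

/-! ### Linear differential equations -/

open scoped BoundedContinuousFunction in
/-- Global solvability of a linear equation with bounded coefficient: in the unknown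
`u t = (cosh (L t))⁻¹ • z t`, with `L` at least twice the bound, the integral equation is a
contraction of the space of bounded continuous functions on the whole line. -/
theorem exists_hasDerivAt_linear {E : Type*} [NormedAddCommGroup E] [NormedSpace ℝ E]
    [CompleteSpace E] {A : ℝ → E →L[ℝ] E} (hA : Continuous A) {K : ℝ} (hK : ∀ t, ‖A t‖ ≤ K)
    (z₀ : E) : ∃ z : ℝ → E, z 0 = z₀ ∧ ∀ t, HasDerivAt z (A t (z t)) t := by
  set L : ℝ := 2 * (|K| + 1) with hL
  have hL0 : 0 < L := by positivity
  have hKL : ∀ t, ‖A t‖ ≤ L / 2 := fun t => by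
    have := hK t; have := le_abs_self K; simp only [hL]; linarith
  have hcosh : Continuous fun r : ℝ => Real.cosh (L * r) := by fun_prop
  have hcont : ∀ u : ℝ →ᵇ E, Continuous fun r => Real.cosh (L * r) • A r (u r) := fun u =>
    hcosh.smul (hA.clm_apply u.continuous)
  -- the primitive `sinh (L t) / L` of `cosh (L t)` is dominated by `cosh (L t) / L`
  have hint : ∀ (f : ℝ → E) (C : ℝ), (∀ r, ‖f r‖ ≤ Real.cosh (L * r) * C) → ∀ t,
      ‖∫ r in (0 : ℝ)..t, f r‖ ≤ Real.cosh (L * t) * (C / L) := by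
    intro f C hf t
    have hC : 0 ≤ C := by
      have := (norm_nonneg _).trans (hf 0)
      simpa using this
    have h1 : ‖∫ r in (0 : ℝ)..t, f r‖ ≤ |∫ r in (0 : ℝ)..t, Real.cosh (L * r) * C| :=
      intervalIntegral.norm_integral_le_abs_of_norm_le (Eventually.of_forall fun r => hf r)
        ((hcosh.mul continuous_const).intervalIntegrable _ _)
    have h2 : ∫ r in (0 : ℝ)..t, Real.cosh (L * r) * C = Real.sinh (L * t) * (C / L) := by
      have hd : ∀ r ∈ uIcc 0 t, HasDerivAt (fun r => Real.sinh (L * r) * (C / L))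
          (Real.cosh (L * r) * C) r := by
        intro r _
        have := (((hasDerivAt_id r).const_mul L).sinh).mul_const (C / L)
        exact this.congr_deriv (by simp only [id]; field_simp)
      rw [intervalIntegral.integral_eq_sub_of_hasDerivAt hd
        ((hcosh.mul continuous_const).intervalIntegrable _ _)]
      simp
    rw [h2, abs_mul, abs_of_nonneg (div_nonneg hC hL0.le)] at h1
    refine h1.trans (mul_le_mul_of_nonneg_right ?_ (div_nonneg hC hL0.le))
    rw [abs_le]
    have e1 := Real.cosh_eq (L * t)
    have e2 := Real.sinh_eq (L * t)
    have := Real.exp_pos (L * t); have := Real.exp_pos (-(L * t))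
    constructor <;> linarith
  have hbd : ∀ (u : ℝ →ᵇ E) r, ‖Real.cosh (L * r) • A r (u r)‖ ≤
      Real.cosh (L * r) * (L / 2 * ‖u‖) := by
    intro u r
    rw [norm_smul, Real.norm_of_nonneg (Real.cosh_pos _).le]
    refine mul_le_mul_of_nonneg_left ?_ (Real.cosh_pos _).le
    exact ((A r).le_opNorm _).trans (mul_le_mul (hKL r) (u.norm_coe_le_norm r) (norm_nonneg _)
      (by positivity))
  let Φ : (ℝ →ᵇ E) → (ℝ →ᵇ E) := fun u => BoundedContinuousFunction.ofNormedAddCommGroup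
    (fun t => (Real.cosh (L * t))⁻¹ • (z₀ + ∫ r in (0 : ℝ)..t, Real.cosh (L * r) • A r (u r)))
    ((hcosh.inv₀ fun t => (Real.cosh_pos _).ne').smul (continuous_const.add
      (intervalIntegral.continuous_primitive (fun a b => (hcont u).intervalIntegrable a b) 0)))
    (‖z₀‖ + L / 2 * ‖u‖ / L) (by
      intro t
      rw [norm_smul, Real.norm_of_nonneg (inv_nonneg.2 (Real.cosh_pos _).le),
        inv_mul_le_iff₀ (Real.cosh_pos _), mul_add]
      refine (norm_add_le _ _).trans (add_le_add ?_ (hint _ _ (hbd u) t))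
      exact le_mul_of_one_le_left (norm_nonneg _) (Real.one_le_cosh _))
  have hΦ : ContractingWith (1 / 2) Φ := by
    refine ⟨by rw [← NNReal.coe_lt_coe]; norm_num, LipschitzWith.of_dist_le_mul fun u v => ?_⟩
    rw [BoundedContinuousFunction.dist_le (by positivity)]
    intro t
    have h1 : Φ u t - Φ v t = (Real.cosh (L * t))⁻¹ •
        ∫ r in (0 : ℝ)..t, Real.cosh (L * r) • A r ((u - v) r) := by
      simp only [Φ, BoundedContinuousFunction.coe_ofNormedAddCommGroup,
        BoundedContinuousFunction.coe_sub, Pi.sub_apply, map_sub]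
      rw [← smul_sub, add_sub_add_left_eq_sub, ← intervalIntegral.integral_sub
        ((hcont u).intervalIntegrable _ _) ((hcont v).intervalIntegrable _ _)]
      simp only [smul_sub]
    rw [dist_eq_norm, h1, norm_smul, Real.norm_of_nonneg (inv_nonneg.2 (Real.cosh_pos _).le),
        inv_mul_le_iff₀ (Real.cosh_pos _)]
    refine (hint _ _ (hbd (u - v)) t).trans (mul_le_mul_of_nonneg_left ?_ (Real.cosh_pos _).le)
    rw [dist_eq_norm]
    refine le_of_eq ?_
    push_cast
    field_simp
  obtain ⟨u, hu⟩ : ∃ u, Φ u = u := ⟨_, hΦ.fixedPoint_isFixedPt⟩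
  have hz : ∀ t, Real.cosh (L * t) • u t =
      z₀ + ∫ r in (0 : ℝ)..t, Real.cosh (L * r) • A r (u r) := by
    intro t
    conv_lhs => rw [← hu]
    simp only [Φ, BoundedContinuousFunction.coe_ofNormedAddCommGroup]
    rw [smul_inv_smul₀ (Real.cosh_pos _).ne']
  refine ⟨fun t => Real.cosh (L * t) • u t, by simpa using hz 0, fun t => ?_⟩
  have h2 : HasDerivAt (fun t => z₀ + ∫ r in (0 : ℝ)..t, Real.cosh (L * r) • A r (u r))
      (Real.cosh (L * t) • A t (u t)) t :=
    (intervalIntegral.integral_hasDerivAt_right ((hcont u).intervalIntegrable _ _)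
      ((hcont u).stronglyMeasurableAtFilter _ _) (hcont u).continuousAt).const_add z₀
  rw [map_smul]
  exact h2.congr_of_eventuallyEq (Eventually.of_forall hz)

/-- `X` is a matrix solution, over the whole line, of the first order system `w' = u`,
`u' = -q w` of the Hill equation `w'' + q w = 0`. -/
def IsHillSolution (q : ℝ → ℝ) (X : ℝ → Matrix (Fin 2) (Fin 2) ℝ) : Prop :=
  ∀ (r : ℝ) (i j : Fin 2), HasDerivAt (fun r' => X r' i j) ((!![0, 1; -(q r), 0] * X r) i j) r

/-- Two matrix solutions of one Hill equation have a constant Wronskian `adjugate X * Z`. -/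
theorem adjugate_mul_eq_of_hill {q : ℝ → ℝ} {X Z : ℝ → Matrix (Fin 2) (Fin 2) ℝ}
    (hX : IsHillSolution q X) (hZ : IsHillSolution q Z) (s t : ℝ) :
    (X t).adjugate * Z t = (X s).adjugate * Z s := by
  have key : ∀ i j : Fin 2, ∀ r, HasDerivAt (fun r' => ((X r').adjugate * Z r') i j) 0 r := by
    intro i j r
    have x00 := hX r 0 0
    have x01 := hX r 0 1
    have x10 := hX r 1 0
    have x11 := hX r 1 1
    have z00 := hZ r 0 0
    have z01 := hZ r 0 1
    have z10 := hZ r 1 0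
    have z11 := hZ r 1 1
    simp only [Matrix.mul_apply, Fin.sum_univ_two, Matrix.of_apply, Matrix.cons_val',
      Matrix.cons_val_zero, Matrix.cons_val_one, Matrix.cons_val_fin_one, zero_mul, one_mul, zero_add, add_zero]
      at x00 x01 x10 x11 z00 z01 z10 z11
    have e : ∀ r', ((X r').adjugate * Z r') i j =
        !![X r' 1 1 * Z r' 0 0 - X r' 0 1 * Z r' 1 0, X r' 1 1 * Z r' 0 1 - X r' 0 1 * Z r' 1 1;
          X r' 0 0 * Z r' 1 0 - X r' 1 0 * Z r' 0 0,
          X r' 0 0 * Z r' 1 1 - X r' 1 0 * Z r' 0 1] i j := by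
      intro r'
      fin_cases i <;> fin_cases j <;>
        simp [Matrix.adjugate_fin_two, Matrix.mul_apply, Fin.sum_univ_two] <;> ring
    refine HasDerivAt.congr_of_eventuallyEq ?_ (Eventually.of_forall e)
    fin_cases i <;> fin_cases j
    · exact ((x11.mul z00).sub (x01.mul z10)).congr_deriv (by ring)
    · exact ((x11.mul z01).sub (x01.mul z11)).congr_deriv (by ring)
    · exact ((x00.mul z10).sub (x10.mul z00)).congr_deriv (by ring)
    · exact ((x00.mul z11).sub (x10.mul z01)).congr_deriv (by ring)
  ext i j
  exact is_const_of_deriv_eq_zero (fun r => (key i j r).differentiableAt)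
    (fun r => (key i j r).deriv) t s

theorem det_eq_one_of_hill {q : ℝ → ℝ} {X : ℝ → Matrix (Fin 2) (Fin 2) ℝ}
    (hX : IsHillSolution q X) {s : ℝ} (hs : X s = 1) (t : ℝ) :
    (X t).det = 1 := by
  have h := adjugate_mul_eq_of_hill hX hX s t
  rw [Matrix.adjugate_mul, hs] at h
  simpa using congrFun (congrFun h 0) 0

/-- The constant Wronskian with the identity as initial value gives uniqueness. -/
theorem eq_of_hill {q : ℝ → ℝ} {X Z : ℝ → Matrix (Fin 2) (Fin 2) ℝ}
    (hX : IsHillSolution q X) (hZ : IsHillSolution q Z) {s : ℝ} (hXs : X s = 1) (hZs : Z s = 1)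
    (t : ℝ) :
    X t = Z t := by
  have h := adjugate_mul_eq_of_hill hX hZ s t
  rw [hXs, hZs] at h
  have h2 : X t * ((X t).adjugate * Z t) = Z t := by
    rw [← mul_assoc, Matrix.mul_adjugate, det_eq_one_of_hill hX hXs]; simp
  rw [← h2, h]; simp

theorem exists_hill_fundamental {q : ℝ → ℝ} (hq : Continuous q) {B : ℝ} (hB : ∀ t, |q t| ≤ B)
    (s : ℝ) : ∃ X : ℝ → Matrix (Fin 2) (Fin 2) ℝ, X s = 1 ∧
      IsHillSolution q X := by
  let A : ℝ → (ℝ × ℝ) →L[ℝ] (ℝ × ℝ) := fun t =>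
    (ContinuousLinearMap.inl ℝ ℝ ℝ).comp (ContinuousLinearMap.snd ℝ ℝ ℝ) -
      q (t + s) • (ContinuousLinearMap.inr ℝ ℝ ℝ).comp (ContinuousLinearMap.fst ℝ ℝ ℝ)
  have hA : Continuous A := continuous_const.sub
    ((hq.comp (continuous_id.add continuous_const)).smul continuous_const)
  have hAb : ∀ t, ‖A t‖ ≤ ‖(ContinuousLinearMap.inl ℝ ℝ ℝ).comp (ContinuousLinearMap.snd ℝ ℝ ℝ)‖ +
      B * ‖(ContinuousLinearMap.inr ℝ ℝ ℝ).comp (ContinuousLinearMap.fst ℝ ℝ ℝ)‖ := by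
    intro t
    refine (norm_sub_le _ _).trans (add_le_add le_rfl ?_)
    rw [norm_smul]
    exact mul_le_mul_of_nonneg_right (hB _) (norm_nonneg _)
  have hcol : ∀ z₀ : ℝ × ℝ, ∃ u v : ℝ → ℝ, (u s, v s) = z₀ ∧ ∀ t, HasDerivAt u (v t) t ∧
      HasDerivAt v (-(q t) * u t) t := by
    intro z₀
    obtain ⟨z, hz0, hz⟩ := exists_hasDerivAt_linear hA hAb z₀
    refine ⟨fun t => (z (t - s)).1, fun t => (z (t - s)).2, by simp [hz0], fun t => ?_⟩
    have h1 : HasDerivAt (fun t => z (t - s)) (A (t - s) (z (t - s))) t :=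
      (hz (t - s)).comp_sub_const t s
    have h2 := (ContinuousLinearMap.fst ℝ ℝ ℝ).hasFDerivAt.comp_hasDerivAt t h1
    have h3 := (ContinuousLinearMap.snd ℝ ℝ ℝ).hasFDerivAt.comp_hasDerivAt t h1
    constructor
    · exact h2.congr_deriv (by simp [A])
    · exact h3.congr_deriv (by simp [A])
  obtain ⟨u, v, h0, huv⟩ := hcol (1, 0)
  obtain ⟨u', v', h0', huv'⟩ := hcol (0, 1)
  rw [Prod.mk.injEq] at h0 h0'
  refine ⟨fun t => !![u t, u' t; v t, v' t], ?_, ?_⟩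
  · ext i j; fin_cases i <;> fin_cases j <;> simp [h0, h0']
  · intro r i j
    have := huv r
    have := huv' r
    fin_cases i <;> fin_cases j <;> simp [Matrix.mul_apply, Fin.sum_univ_two] <;> simp_all

/-! ### The potential near its maximum -/

namespace IsAdmissiblePotential

variable {V : ℝ → ℝ}

theorem hasDerivAt (hV : IsAdmissiblePotential V) (x : ℝ) : HasDerivAt V (deriv V x) x :=
  (hV.contDiff.differentiable (by norm_num) x).hasDerivAt

theorem contDiff_deriv (hV : IsAdmissiblePotential V) : ContDiff ℝ 1 (deriv V) := by
  have h : ContDiff ℝ (1 + 1) V := by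
    have := hV.contDiff
    norm_num
    exact this
  exact (contDiff_succ_iff_deriv.1 h).2.2

theorem hasDerivAt_deriv (hV : IsAdmissiblePotential V) (x : ℝ) :
    HasDerivAt (deriv V) (deriv (deriv V) x) x :=
  (hV.contDiff_deriv.differentiable (by norm_num) x).hasDerivAt

theorem continuous (hV : IsAdmissiblePotential V) : Continuous V := hV.contDiff.continuous

theorem continuous_deriv_deriv (hV : IsAdmissiblePotential V) :
    Continuous (deriv (deriv V)) := hV.contDiff_deriv.continuous_deriv le_rfl

theorem periodic_deriv_deriv (hV : IsAdmissiblePotential V) :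
    Function.Periodic (deriv (deriv V)) (2 * π) := by
  have h : ∀ f : ℝ → ℝ, Function.Periodic f (2 * π) → Function.Periodic (deriv f) (2 * π) := by
    intro f hf x
    rw [← deriv_comp_add_const, show (fun x => f (x + 2 * π)) = f from funext hf]
  exact h _ (h _ hV.periodic)

theorem exists_abs_deriv_deriv_le (hV : IsAdmissiblePotential V) :
    ∃ B, ∀ x, |deriv (deriv V) x| ≤ B := by
  obtain ⟨B, hB⟩ := isCompact_Icc.exists_bound_of_continuousOn (s := Icc 0 (2 * π))
    hV.continuous_deriv_deriv.continuousOn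
  refine ⟨B, fun x => ?_⟩
  obtain ⟨y, hy, hxy⟩ := hV.periodic_deriv_deriv.exists_mem_Ico₀ (by positivity) x
  rw [hxy]
  exact hB y (Ico_subset_Icc_self hy)

theorem neg_of_abs_le (hV : IsAdmissiblePotential V) {s : ℝ} (hs : |s| ≤ π) (h0 : s ≠ 0) :
    V (π + s) < 0 := by
  refine hV.neg_elsewhere _ fun n hn => ?_
  have h1 : s = 2 * π * n := by linarith
  have h2 : n ≠ 0 := by rintro rfl; simp at h1; exact h0 h1
  have h3 : (1 : ℝ) ≤ |(n : ℝ)| := by exact_mod_cast Int.one_le_abs h2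
  rw [h1, abs_mul, abs_of_pos (by positivity)] at hs
  nlinarith [pi_pos]

theorem nonpos (hV : IsAdmissiblePotential V) (x : ℝ) : V x ≤ 0 := by
  by_cases h : ∀ n : ℤ, x ≠ π + 2 * π * n
  · exact (hV.neg_elsewhere x h).le
  · push Not at h
    obtain ⟨n, rfl⟩ := h
    have := hV.periodic.int_mul n π
    rw [mul_comm (2 * π), this, hV.max_eq_zero]

theorem sub_pos (hV : IsAdmissiblePotential V) {E : ℝ} (hE : 0 < E) (x : ℝ) : 0 < E - V x := by
  linarith [hV.nonpos x]

theorem deriv_pi (hV : IsAdmissiblePotential V) : deriv V π = 0 := by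
  refine IsLocalMax.deriv_eq_zero (Eventually.of_forall fun x => ?_)
  rw [hV.max_eq_zero]; exact hV.nonpos x

/-- The Lipschitz condition at the maximum extends, by boundedness of `V''`, to a whole period. -/
theorem exists_abs_deriv_deriv_sub_le (hV : IsAdmissiblePotential V) :
    ∃ K, 0 < K ∧ ∀ s, |deriv (deriv V) (π + s) - deriv (deriv V) π| ≤ K * |s| := by
  obtain ⟨C, hC0, hC⟩ := hV.lipschitz_at_max.exists_pos
  obtain ⟨δ, hδ, hδC⟩ := Metric.eventually_nhds_iff.1 hC.bound
  obtain ⟨B, hB⟩ := hV.exists_abs_deriv_deriv_le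
  have hB0 : 0 ≤ B := (abs_nonneg _).trans (hB 0)
  refine ⟨C + 2 * B / δ, by positivity, fun s => ?_⟩
  have hs0 := abs_nonneg s
  have hBδ : 0 ≤ 2 * B / δ := by positivity
  rcases lt_or_ge |s| δ with h | h
  · have := hδC (y := π + s) (by simpa [Real.dist_eq] using h)
    simp only [Real.norm_eq_abs, add_sub_cancel_left] at this
    nlinarith [mul_nonneg hBδ hs0]
  · have h1 : |deriv (deriv V) (π + s) - deriv (deriv V) π| ≤ 2 * B := by
      refine (abs_sub _ _).trans ?_
      linarith [hB (π + s), hB π]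
    have h2 : 2 * B ≤ 2 * B / δ * |s| := by
      rw [div_mul_eq_mul_div, le_div_iff₀ hδ]
      exact mul_le_mul_of_nonneg_left h (by positivity)
    nlinarith [mul_nonneg hC0.le hs0]

/-- Taylor expansion of the potential at its maximum, with cubic remainder. -/
theorem exists_abs_taylor_le (hV : IsAdmissiblePotential V) :
    ∃ K, 0 < K ∧ ∀ s, |-deriv (deriv V) π * s ^ 2 + 2 * V (π + s)| ≤ K * |s| ^ 3 := by
  obtain ⟨K, hK, hKs⟩ := hV.exists_abs_deriv_deriv_sub_le
  set m := deriv (deriv V) π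
  have hshift : ∀ x, HasDerivAt (fun s : ℝ => π + s) 1 x := fun x => (hasDerivAt_id x).const_add π
  have hd1 : ∀ x, HasDerivAt (fun s => V (π + s)) (deriv V (π + x)) x := fun x => by
    simpa using HasDerivAt.comp_const_add π x (hV.hasDerivAt (π + x))
  have hd2 : ∀ x, HasDerivAt (fun s => deriv V (π + s)) (deriv (deriv V) (π + x)) x := fun x => by
    simpa using HasDerivAt.comp_const_add π x (hV.hasDerivAt_deriv (π + x))
  have hmem : ∀ {s : ℝ}, s ∈ Icc (-|s|) |s| := fun {s} => ⟨neg_abs_le s, le_abs_self s⟩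
  have h0mem : ∀ {s : ℝ}, (0 : ℝ) ∈ Icc (-|s|) |s| := fun {s} => ⟨by simp, by simp⟩
  have b1 : ∀ s, |deriv V (π + s) - m * s| ≤ K * |s| ^ 2 := by
    intro s
    have := (convex_Icc (-|s|) |s|).norm_image_sub_le_of_norm_hasDerivWithin_le
      (f := fun s => deriv V (π + s) - m * s) (C := K * |s|)
      (fun x _ => ((hd2 x).sub ((hasDerivAt_id x).const_mul m)).hasDerivWithinAt)
      (fun x hx => ?_) h0mem hmem
    · simpa [hV.deriv_pi, pow_two, mul_assoc] using this
    · rw [mul_one, Real.norm_eq_abs]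
      exact (hKs x).trans (mul_le_mul_of_nonneg_left (abs_le.2 hx) hK.le)
  have b2 : ∀ s, |V (π + s) - m * s ^ 2 / 2| ≤ K * |s| ^ 3 := by
    intro s
    have := (convex_Icc (-|s|) |s|).norm_image_sub_le_of_norm_hasDerivWithin_le
      (f := fun s => V (π + s) - m * s ^ 2 / 2) (f' := fun s => deriv V (π + s) - m * s)
      (C := K * |s| ^ 2)
      (fun x _ => (((hd1 x).sub ((((hasDerivAt_id x).pow 2).const_mul m).div_const
        2)).congr_deriv (by simp only [id]; ring)).hasDerivWithinAt)
      (fun x hx => ?_) h0mem hmem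
    · simp [hV.max_eq_zero] at this
      calc _ ≤ _ := this
        _ = _ := by rw [← sq_abs]; ring
    · rw [Real.norm_eq_abs]
      refine (b1 x).trans (mul_le_mul_of_nonneg_left ?_ hK.le)
      exact pow_le_pow_left₀ (abs_nonneg x) (abs_le.2 hx) 2
  refine ⟨2 * K, by positivity, fun s => ?_⟩
  have : -m * s ^ 2 + 2 * V (π + s) = 2 * (V (π + s) - m * s ^ 2 / 2) := by ring
  rw [this, abs_mul, abs_two, mul_assoc]
  exact mul_le_mul_of_nonneg_left (b2 s) two_pos.le

/-- Nondegeneracy of the maximum, made uniform over a period by compactness. -/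
theorem exists_mul_sq_le_neg (hV : IsAdmissiblePotential V) :
    ∃ c, 0 < c ∧ ∀ s, |s| ≤ π → c * s ^ 2 ≤ -V (π + s) := by
  obtain ⟨K, hK, hKs⟩ := hV.exists_abs_taylor_le
  have hm := hV.nondegenerate
  set m := deriv (deriv V) π
  set δ : ℝ := -m / (2 * K) with hδ
  have hδ0 : 0 < δ := div_pos (by linarith) (by positivity)
  have near : ∀ s, |s| ≤ δ → -m / 4 * s ^ 2 ≤ -V (π + s) := by
    intro s hs
    have h1 := (le_abs_self _).trans (hKs s)
    have h2 : K * |s| ^ 3 ≤ -m / 2 * s ^ 2 := by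
      have : K * |s| ≤ -m / 2 := by
        rw [hδ, le_div_iff₀ (by positivity)] at hs; linarith
      calc K * |s| ^ 3 = K * |s| * s ^ 2 := by rw [← sq_abs]; ring
        _ ≤ _ := mul_le_mul_of_nonneg_right this (sq_nonneg s)
    linarith
  have hcomp : IsCompact {s : ℝ | s ∈ Icc (-π) π ∧ δ ≤ |s|} :=
    isCompact_Icc.inter_right (isClosed_le continuous_const continuous_abs)
  have hcont : Continuous fun s => -V (π + s) :=
    (hV.continuous.comp (continuous_const.add continuous_id)).neg
  have far : ∃ c, 0 < c ∧ ∀ s, |s| ≤ π → δ ≤ |s| → c ≤ -V (π + s) := by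
    rcases eq_empty_or_nonempty {s : ℝ | s ∈ Icc (-π) π ∧ δ ≤ |s|} with h | h
    · exact ⟨1, one_pos, fun s h1 h2 => absurd (show s ∈ {s : ℝ | s ∈ Icc (-π) π ∧ δ ≤ |s|} from
        ⟨abs_le.1 h1, h2⟩) (by rw [h]; exact notMem_empty s)⟩
    · obtain ⟨x, hx, hmin⟩ := hcomp.exists_isMinOn h hcont.continuousOn
      have hx0 : x ≠ 0 := by
        rintro rfl
        have := hx.2
        rw [abs_zero] at this
        linarith
      refine ⟨-V (π + x), by linarith [hV.neg_of_abs_le (abs_le.2 hx.1) hx0], fun s h1 h2 =>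
        hmin (show s ∈ {s : ℝ | s ∈ Icc (-π) π ∧ δ ≤ |s|} from ⟨abs_le.1 h1, h2⟩)⟩
  obtain ⟨c, hc, hfar⟩ := far
  have hpi : (0 : ℝ) < π ^ 2 := by positivity
  refine ⟨min (-m / 4) (c / π ^ 2), lt_min (by linarith) (by positivity), fun s hs => ?_⟩
  rcases le_total |s| δ with h | h
  · exact (mul_le_mul_of_nonneg_right (min_le_left _ _) (sq_nonneg s)).trans (near s h)
  · refine (mul_le_mul_of_nonneg_right (min_le_right _ _) (sq_nonneg s)).trans
      (le_trans ?_ (hfar s hs h))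
    rw [div_mul_eq_mul_div, div_le_iff₀ hpi]
    refine mul_le_mul_of_nonneg_left ?_ hc.le
    rw [← sq_abs]
    exact pow_le_pow_left₀ (abs_nonneg s) hs 2

/-- On `[-π, π]`, both ends of which are maxima, the distance to the nearest maximum is
`π - |x|`. -/
theorem apply_eq_shift (hV : IsAdmissiblePotential V) {x : ℝ} (hx : |x| ≤ π) :
    ∃ s, |s| = π - |x| ∧ V x = V (π + s) ∧ deriv (deriv V) x = deriv (deriv V) (π + s) := by
  rcases le_total 0 x with h | h
  · rw [abs_of_nonneg h] at *
    exact ⟨x - π, by rw [abs_of_nonpos (by linarith)]; ring, by simp, by simp⟩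
  · rw [abs_of_nonpos h] at *
    refine ⟨x + π, by rw [abs_of_nonneg (by linarith)]; ring, ?_, ?_⟩
    · rw [← hV.periodic x]; ring_nf
    · rw [← hV.periodic_deriv_deriv x]; ring_nf

end IsAdmissiblePotential

/-! ### The rotating synchronous solution -/

/-- The time at which the synchronous solution of energy `E` that starts from `0` reaches `x`.
For `|x| < π` the value at `E = 0` is the time along the separatrix. -/
noncomputable def rotationTime (V : ℝ → ℝ) (E x : ℝ) : ℝ :=
  1 / √2 * ∫ y in (0 : ℝ)..x, 1 / √(E - V y)

namespace IsAdmissiblePotential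

variable {V : ℝ → ℝ} {E : ℝ}

theorem continuous_one_div_sqrt (hV : IsAdmissiblePotential V) (hE : 0 < E) :
    Continuous fun y => 1 / √(E - V y) :=
  continuous_const.div (continuous_const.sub hV.continuous).sqrt fun y =>
    (Real.sqrt_pos.2 (hV.sub_pos hE y)).ne'

theorem hasDerivAt_rotationTime (hV : IsAdmissiblePotential V) (hE : 0 < E) (x : ℝ) :
    HasDerivAt (rotationTime V E) (1 / √2 * (1 / √(E - V x))) x :=
  (intervalIntegral.integral_hasDerivAt_right
    ((hV.continuous_one_div_sqrt hE).intervalIntegrable _ _)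
    ((hV.continuous_one_div_sqrt hE).stronglyMeasurableAtFilter _ _)
    (hV.continuous_one_div_sqrt hE).continuousAt).const_mul _

theorem continuous_rotationTime (hV : IsAdmissiblePotential V) (hE : 0 < E) :
    Continuous (rotationTime V E) :=
  continuous_iff_continuousAt.2 fun x => (hV.hasDerivAt_rotationTime hE x).continuousAt

theorem rotationTime_strictMono (hV : IsAdmissiblePotential V) (hE : 0 < E) :
    StrictMono (rotationTime V E) := by
  refine strictMono_of_deriv_pos fun x => ?_
  rw [(hV.hasDerivAt_rotationTime hE x).deriv]
  have := Real.sqrt_pos.2 (hV.sub_pos hE x)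
  positivity

theorem rotationTime_sub_eq (hV : IsAdmissiblePotential V) (hE : 0 < E) (a b : ℝ) :
    rotationTime V E b - rotationTime V E a = 1 / √2 * ∫ y in a..b, 1 / √(E - V y) := by
  have h := fun a b => (hV.continuous_one_div_sqrt hE).intervalIntegrable
    (μ := MeasureTheory.volume) a b
  rw [rotationTime, rotationTime, ← mul_sub,
    intervalIntegral.integral_interval_sub_left (h _ _) (h _ _)]

theorem rotationTime_pi_sub (hV : IsAdmissiblePotential V) (hE : 0 < E) :
    rotationTime V E π - rotationTime V E (-π) = rotationPeriod V E :=
  hV.rotationTime_sub_eq hE _ _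

theorem rotationTime_add_two_pi (hV : IsAdmissiblePotential V) (hE : 0 < E) (x : ℝ) :
    rotationTime V E (x + 2 * π) = rotationTime V E x + rotationPeriod V E := by
  have hp : Function.Periodic (fun y => 1 / √(E - V y)) (2 * π) := fun y => by
    simp only [hV.periodic y]
  have h := hp.intervalIntegral_add_eq x (-π)
  rw [show -π + 2 * π = π by ring] at h
  rw [rotationPeriod, ← h, ← hV.rotationTime_sub_eq hE]
  ring

theorem rotationPeriod_pos (hV : IsAdmissiblePotential V) (hE : 0 < E) :
    0 < rotationPeriod V E := by
  rw [← hV.rotationTime_pi_sub hE]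
  linarith [hV.rotationTime_strictMono hE (show -π < π by linarith [pi_pos])]

theorem rotationTime_surjective (hV : IsAdmissiblePotential V) (hE : 0 < E) :
    Function.Surjective (rotationTime V E) := by
  have h0 : rotationTime V E 0 = 0 := by simp [rotationTime]
  have hT := hV.rotationPeriod_pos hE
  have key : ∀ n : ℤ, rotationTime V E (n * (2 * π)) = n * rotationPeriod V E := by
    intro n
    induction n using Int.induction_on with
    | zero => simp [h0]
    | succ n ih =>
      have := hV.rotationTime_add_two_pi hE ((n : ℤ) * (2 * π))
      rw [ih] at this
      push_cast at this ⊢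
      rw [add_mul, one_mul, this]; ring
    | pred n ih =>
      have := hV.rotationTime_add_two_pi hE (((-n - 1 : ℤ) : ℝ) * (2 * π))
      rw [show ((-n - 1 : ℤ) : ℝ) * (2 * π) + 2 * π = (-n : ℤ) * (2 * π) by push_cast; ring,
        ih] at this
      push_cast at this ⊢
      linarith
  intro t
  obtain ⟨n, hn⟩ := exists_int_gt (t / rotationPeriod V E)
  obtain ⟨m, hm⟩ := exists_int_lt (t / rotationPeriod V E)
  rw [div_lt_iff₀ hT] at hn
  rw [lt_div_iff₀ hT] at hm
  exact mem_range_of_exists_le_of_exists_ge (hV.continuous_rotationTime hE)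
    ⟨m * (2 * π), by rw [key]; exact hm.le⟩ ⟨n * (2 * π), by rw [key]; exact hn.le⟩

end IsAdmissiblePotential

namespace IsSynchronousSolution

variable {V : ℝ → ℝ} {E : ℝ} {p : ℝ → ℝ}

theorem deriv_eq (hV : IsAdmissiblePotential V) (hE : 0 < E) (hp : IsSynchronousSolution V E p)
    (t : ℝ) : deriv p t = √2 * √(E - V (p t)) := by
  have hne : ∀ t, deriv p t ≠ 0 := fun t h => by
    have := hp.energy t
    rw [h] at this
    linarith [hV.sub_pos hE (p t)]
  have hcont : Continuous (deriv p) :=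
    continuous_iff_continuousAt.2 fun t => (hp.ode t).continuousAt
  have hpos : 0 < deriv p t := by
    by_contra! h
    obtain ⟨s, hs⟩ := mem_range_of_exists_le_of_exists_ge hcont ⟨t, h⟩ ⟨0, hp.increasing.le⟩
    exact hne s hs
  rw [← Real.sqrt_mul zero_le_two, ← hp.energy t,
    show 2 * (deriv p t ^ 2 / 2 + V (p t) - V (p t)) = deriv p t ^ 2 by ring,
    Real.sqrt_sq hpos.le]

/-- Separation of variables: a synchronous solution is the inverse function of `rotationTime`, which
gives its uniqueness. -/
theorem rotationTime_apply (hV : IsAdmissiblePotential V) (hE : 0 < E)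
    (hp : IsSynchronousSolution V E p) (t : ℝ) : rotationTime V E (p t) = t := by
  have h : ∀ t, HasDerivAt (fun t => rotationTime V E (p t) - t) 0 t := by
    intro t
    have := ((hV.hasDerivAt_rotationTime hE (p t)).comp t (hp.differentiable t).hasDerivAt).sub
      (hasDerivAt_id t)
    refine this.congr_deriv ?_
    have := Real.sqrt_pos.2 (hV.sub_pos hE (p t))
    rw [hp.deriv_eq hV hE]
    field_simp
    simp
  have := is_const_of_deriv_eq_zero (fun t => (h t).differentiableAt) (fun t => (h t).deriv) t 0
  simp only [hp.initial, rotationTime, intervalIntegral.integral_same] at this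
  rw [rotationTime]
  linarith

theorem apply_rotationTime (hV : IsAdmissiblePotential V) (hE : 0 < E)
    (hp : IsSynchronousSolution V E p) (x : ℝ) : p (rotationTime V E x) = x :=
  (hV.rotationTime_strictMono hE).injective (hp.rotationTime_apply hV hE _)

theorem add_rotationPeriod (hV : IsAdmissiblePotential V) (hE : 0 < E)
    (hp : IsSynchronousSolution V E p) (t : ℝ) : p (t + rotationPeriod V E) = p t + 2 * π := by
  refine (hV.rotationTime_strictMono hE).injective ?_
  rw [hp.rotationTime_apply hV hE, hV.rotationTime_add_two_pi hE, hp.rotationTime_apply hV hE]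

theorem unique (hV : IsAdmissiblePotential V) (hE : 0 < E)
    {q : ℝ → ℝ} (hp : IsSynchronousSolution V E p) (hq : IsSynchronousSolution V E q) :
    p = q := by
  funext t
  refine (hV.rotationTime_strictMono hE).injective ?_
  rw [hp.rotationTime_apply hV hE, hq.rotationTime_apply hV hE]

end IsSynchronousSolution

/-- The inverse function of `rotationTime` is a synchronous solution. -/
theorem exists_isSynchronousSolution {V : ℝ → ℝ} (hV : IsAdmissiblePotential V) {E : ℝ}
    (hE : 0 < E) : ∃ p, IsSynchronousSolution V E p := by
  let e := StrictMono.orderIsoOfSurjective _ (hV.rotationTime_strictMono hE)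
    (hV.rotationTime_surjective hE)
  have he : ∀ x, e x = rotationTime V E x := fun x => rfl
  have hder : ∀ t, HasDerivAt e.symm (√2 * √(E - V (e.symm t))) t := by
    intro t
    have hs := Real.sqrt_pos.2 (hV.sub_pos hE (e.symm t))
    have := HasDerivAt.of_local_left_inverse (f := rotationTime V E) (g := e.symm)
      (e.symm.continuous.continuousAt) (hV.hasDerivAt_rotationTime hE (e.symm t))
      (by positivity) (Eventually.of_forall fun s => e.apply_symm_apply s)
    exact this.congr_deriv (by field_simp)
  have hderiv : deriv e.symm = fun t => √2 * √(E - V (e.symm t)) := funext fun t => (hder t).deriv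
  refine ⟨e.symm, fun t => (hder t).differentiableAt, fun t => ?_, fun t => ?_, ?_, ?_⟩
  · rw [hderiv]
    have hs := hV.sub_pos hE (e.symm t)
    have h1 := ((((hV.hasDerivAt (e.symm t)).comp t (hder t)).const_sub E).sqrt hs.ne').const_mul √2
    refine h1.congr_deriv ?_
    have h2 := Real.sqrt_pos.2 hs
    have h3 : √2 * √2 = (2 : ℝ) := Real.mul_self_sqrt zero_le_two
    simp only [Function.comp]
    field_simp
    linear_combination (-deriv V (e.symm t)) * h3
  · rw [hderiv]
    simp only [mul_pow, Real.sq_sqrt zero_le_two, Real.sq_sqrt (hV.sub_pos hE _).le]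
    ring
  · rw [OrderIso.symm_apply_eq, he]; simp [rotationTime]
  · rw [hderiv]
    have hs := Real.sqrt_pos.2 (hV.sub_pos hE (e.symm 0))
    positivity

theorem existsUnique_isFloquetMatrix {V : ℝ → ℝ} (hV : IsAdmissiblePotential V) (κ : ℝ) {E : ℝ}
    (hE : 0 < E) : ∃! M : Matrix (Fin 2) (Fin 2) ℝ, IsFloquetMatrix V κ E M := by
  obtain ⟨p, hp⟩ := exists_isSynchronousSolution hV hE
  obtain ⟨B, hB⟩ := hV.exists_abs_deriv_deriv_le
  obtain ⟨X, hX0, hX⟩ := exists_hill_fundamental (q := fun t => 2 * κ + deriv (deriv V) (p t))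
    (continuous_const.add (hV.continuous_deriv_deriv.comp hp.differentiable.continuous))
    (fun t => (abs_add_le _ _).trans (add_le_add_right (hB (p t)) _)) (-(rotationPeriod V E / 2))
  refine ⟨X (rotationPeriod V E / 2), ⟨p, hp, X, hX, hX0, rfl⟩, ?_⟩
  rintro M ⟨p', hp', Z, hZ, hZ0, rfl⟩
  obtain rfl := hp'.unique hV hE hp
  exact eq_of_hill hZ hX hZ0 hX0 _

/-! ### Amplitudes in the rotating frame -/

/-- Amplitudes of a Hill equation in the rotating frame. With `ζ = w + i w' / ω` the advance matrix
becomes a real linear map `ζ ↦ α ζ + β conj ζ` of `ℂ`, and `a`, `c` are `α`, `conj β` up to the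
phases of the free rotation; `‖a‖² - ‖c‖² = 1` is the determinant. -/
theorem exists_amplitudes_of_hill {ω : ℝ} (hω : 0 < ω) {g : ℝ → ℝ}
    {Y : ℝ → Matrix (Fin 2) (Fin 2) ℝ}
    (hY : IsHillSolution (fun t => ω ^ 2 + g t) Y) {t₀ : ℝ} (hY0 : Y t₀ = 1) :
    ∃ a c : ℝ → ℂ, a t₀ = 1 ∧ c t₀ = 0 ∧ ∀ t,
      HasDerivAt a (-(Complex.I * ↑(g t / (2 * ω))) *
        (a t + Complex.exp (2 * ω * t * Complex.I) * c t)) t ∧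
      HasDerivAt c ((Complex.I * ↑(g t / (2 * ω))) *
        (c t + Complex.exp (-(2 * ω * t * Complex.I)) * a t)) t ∧
      ‖a t‖ ^ 2 = 1 + ‖c t‖ ^ 2 ∧
      (Y t).trace = 2 * (Complex.exp (-(ω * (t - t₀) * Complex.I)) * a t).re := by
  have hωc : (ω : ℂ) ≠ 0 := by exact_mod_cast hω.ne'
  have hdet : ∀ t, Y t 0 0 * Y t 1 1 - Y t 0 1 * Y t 1 0 = 1 := fun t => by
    rw [← Matrix.det_fin_two, det_eq_one_of_hill hY hY0]
  set A : ℝ → ℂ := fun t => ((Y t 0 0 : ℂ) + Y t 1 1) / 2 +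
    Complex.I * ((Y t 1 0 : ℂ) / ω - ω * Y t 0 1) / 2 with hAdef
  set C : ℝ → ℂ := fun t => ((Y t 0 0 : ℂ) - Y t 1 1) / 2 -
    Complex.I * ((Y t 1 0 : ℂ) / ω + ω * Y t 0 1) / 2 with hCdef
  have hI : Complex.I * Complex.I = -1 := Complex.I_mul_I
  have hder : ∀ t, HasDerivAt A (-(ω * Complex.I) * A t -
        Complex.I * ↑(g t / (2 * ω)) * (A t + C t)) t ∧
      HasDerivAt C (ω * Complex.I * C t + Complex.I * ↑(g t / (2 * ω)) * (A t + C t)) t := by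
    intro t
    have y00 := hY t 0 0
    have y01 := hY t 0 1
    have y10 := hY t 1 0
    have y11 := hY t 1 1
    simp only [Matrix.mul_apply, Fin.sum_univ_two, Matrix.of_apply, Matrix.cons_val',
      Matrix.cons_val_zero, Matrix.cons_val_one, Matrix.cons_val_fin_one, zero_mul, one_mul,
      zero_add, add_zero] at y00 y01 y10 y11
    replace y00 := y00.ofReal_comp
    replace y01 := y01.ofReal_comp
    replace y10 := y10.ofReal_comp
    replace y11 := y11.ofReal_comp
    constructor
    · refine (((y00.add y11).div_const 2).add ((((y10.div_const (ω : ℂ)).sub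
        (y01.const_mul (ω : ℂ))).const_mul Complex.I).div_const 2)).congr_deriv ?_
      simp only [hAdef, hCdef]
      push_cast
      field_simp
      ring_nf
      simp only [Complex.I_sq]
      ring
    · refine (((y00.sub y11).div_const 2).sub ((((y10.div_const (ω : ℂ)).add
        (y01.const_mul (ω : ℂ))).const_mul Complex.I).div_const 2)).congr_deriv ?_
      simp only [hAdef, hCdef]
      push_cast
      field_simp
      ring_nf
      simp only [Complex.I_sq]
      ring
  have hnorm : ∀ t, ‖A t‖ ^ 2 = 1 + ‖C t‖ ^ 2 := by
    intro t
    have e1 : A t = ↑((Y t 0 0 + Y t 1 1) / 2) + ↑((Y t 1 0 / ω - ω * Y t 0 1) / 2) *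
        Complex.I := by
      simp only [hAdef]; push_cast; ring
    have e2 : C t = ↑((Y t 0 0 - Y t 1 1) / 2) + ↑(-(Y t 1 0 / ω + ω * Y t 0 1) / 2) *
        Complex.I := by
      simp only [hCdef]; push_cast; ring
    rw [e1, e2, ← Complex.normSq_eq_norm_sq, ← Complex.normSq_eq_norm_sq,
      Complex.normSq_add_mul_I, Complex.normSq_add_mul_I]
    have h3 : Y t 1 0 / ω * (ω * Y t 0 1) = Y t 0 1 * Y t 1 0 := by field_simp
    linear_combination hdet t - h3
  have hexp : ∀ (k d : ℂ) (t : ℝ), HasDerivAt (fun t : ℝ => Complex.exp (k * (t + d)))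
      (k * Complex.exp (k * (t + d))) t := by
    intro k d t
    have h1 : HasDerivAt (fun t : ℝ => k * ((t : ℂ) + d)) (k * 1) t :=
      ((Complex.ofRealCLM.hasDerivAt (x := t)).add_const d).const_mul k
    exact h1.cexp.congr_deriv (by ring)
  refine ⟨fun t => Complex.exp (ω * Complex.I * (t + -t₀)) * A t,
    fun t => Complex.exp (-(ω * Complex.I) * (t + t₀)) * C t, ?_, ?_, fun t => ⟨?_, ?_, ?_, ?_⟩⟩
  · simp [hAdef, hY0]
  · simp [hCdef, hY0]
  · refine ((hexp (ω * Complex.I) (-t₀) t).mul (hder t).1).congr_deriv ?_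
    have e1 : Complex.exp (2 * ω * t * Complex.I) *
        (Complex.exp (-(ω * Complex.I) * (t + t₀)) * C t)
        = Complex.exp (ω * Complex.I * (t + -t₀)) * C t := by
      rw [← mul_assoc, ← Complex.exp_add]; ring_nf
    rw [e1]; ring
  · refine ((hexp (-(ω * Complex.I)) t₀ t).mul (hder t).2).congr_deriv ?_
    have e1 : Complex.exp (-(2 * ω * t * Complex.I)) *
        (Complex.exp (ω * Complex.I * (t + -t₀)) * A t)
        = Complex.exp (-(ω * Complex.I) * (t + t₀)) * A t := by
      rw [← mul_assoc, ← Complex.exp_add]; ring_nf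
    rw [e1]; ring
  · have h1 : ‖Complex.exp (ω * Complex.I * (t + -t₀))‖ = 1 := by
      rw [show (ω : ℂ) * Complex.I * (t + -t₀) = ↑(ω * (t + -t₀)) * Complex.I by push_cast; ring,
        Complex.norm_exp_ofReal_mul_I]
    have h2 : ‖Complex.exp (-(ω * Complex.I) * (t + t₀))‖ = 1 := by
      rw [show -((ω : ℂ) * Complex.I) * (t + t₀) = ↑(-ω * (t + t₀)) * Complex.I by push_cast; ring,
        Complex.norm_exp_ofReal_mul_I]
    simp only [norm_mul, h1, h2, one_mul]
    exact hnorm t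
  · have e1 : Complex.exp (-(ω * (t - t₀) * Complex.I)) *
        (Complex.exp (ω * Complex.I * (t + -t₀)) * A t) = A t := by
      rw [← mul_assoc, ← Complex.exp_add]; ring_nf; simp
    rw [e1]
    simp [hAdef, Matrix.trace_fin_two]
    ring

/-- The density, in the angle variable `x = p(t; E)`, of the perturbation of the free rotation. -/
noncomputable def scatteringDensity (V : ℝ → ℝ) (ω E x : ℝ) : ℝ :=
  (deriv (deriv V) x - deriv (deriv V) π) * (1 / √2 * (1 / √(E - V x))) / (2 * ω)

/-- The phase factor `exp (2 i ω t)` of the free rotation, at the time `t` when `p(t; E) = x`. -/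
noncomputable def rotationPhase (V : ℝ → ℝ) (ω E x : ℝ) : ℂ :=
  Complex.exp (2 * ω * rotationTime V E x * Complex.I)

/-- `(a, c)` solves the amplitude equations with density `s` and phase factor `e`. -/
def IsAmplitudeSolution (s : ℝ → ℝ) (e a c : ℝ → ℂ) : Prop :=
  ∀ x, HasDerivAt a (-(Complex.I * ↑(s x)) * (a x + e x * c x)) x ∧
    HasDerivAt c ((Complex.I * ↑(s x)) * (c x + (e x)⁻¹ * a x)) x

/-- The Floquet matrix over one period has, up to conjugation, the form "free rotation times
scattering matrix" once the period is cut at the passages through the maximum. -/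
theorem exists_amplitudes {V : ℝ → ℝ} (hV : IsAdmissiblePotential V) {κ ω : ℝ} (hω : 0 < ω)
    (hω2 : ω ^ 2 = 2 * κ + deriv (deriv V) π) {E : ℝ} (hE : 0 < E)
    {M : Matrix (Fin 2) (Fin 2) ℝ} (hM : IsFloquetMatrix V κ E M) :
    M.det = 1 ∧ ∃ a c : ℝ → ℂ, a (-π) = 1 ∧ c (-π) = 0 ∧
      IsAmplitudeSolution (scatteringDensity V ω E) (rotationPhase V ω E) a c ∧
      (∀ x, ‖a x‖ ^ 2 = 1 + ‖c x‖ ^ 2) ∧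
      M.trace = 2 * (Complex.exp (-(ω * rotationPeriod V E * Complex.I)) * a π).re := by
  obtain ⟨p, hp, X, hX, hXs, rfl⟩ := hM
  set T := rotationPeriod V E with hT
  set t₀ := rotationTime V E (-π)
  have hX' : IsHillSolution (fun t => 2 * κ + deriv (deriv V) (p t)) X := hX
  have hdet := det_eq_one_of_hill hX' hXs
  refine ⟨hdet _, ?_⟩
  -- periodicity of the coefficient: the trace does not depend on where the period starts
  have hshift : IsHillSolution (fun t => 2 * κ + deriv (deriv V) (p t)) (fun t => X (t + T)) := by
    intro r i j
    have h := (hX' (r + T) i j).comp_add_const r T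
    beta_reduce at h ⊢
    rwa [hp.add_rotationPeriod hV hE, hV.periodic_deriv_deriv] at h
  have htrace : (X (t₀ + T) * (X t₀).adjugate).trace = (X (T / 2)).trace := by
    have h := adjugate_mul_eq_of_hill hX' hshift (-(T / 2)) t₀
    rw [Matrix.trace_mul_comm, h, hXs, show -(T / 2) + T = T / 2 by ring]
    simp
  have hY : IsHillSolution
      (fun t => ω ^ 2 + (deriv (deriv V) (p t) - deriv (deriv V) π))
      (fun t => X t * (X t₀).adjugate) := by
    intro r i j
    beta_reduce
    rw [show ω ^ 2 + (deriv (deriv V) (p r) - deriv (deriv V) π) =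
      2 * κ + deriv (deriv V) (p r) by rw [hω2]; ring, ← mul_assoc]
    refine ((((hX' r i 0).mul_const ((X t₀).adjugate 0 j)).add
      ((hX' r i 1).mul_const ((X t₀).adjugate 1 j))).congr_deriv ?_).congr_of_eventuallyEq
      (Eventually.of_forall fun r' => ?_)
    · conv_rhs => rw [Matrix.mul_apply, Fin.sum_univ_two]
    · change (X r' * (X t₀).adjugate) i j = _
      rw [Matrix.mul_apply, Fin.sum_univ_two]
      rfl
  obtain ⟨a, c, ha0, hc0, hac⟩ := exists_amplitudes_of_hill hω hY (t₀ := t₀)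
    (by rw [Matrix.mul_adjugate, hdet, one_smul])
  refine ⟨a ∘ rotationTime V E, c ∘ rotationTime V E, ha0, hc0, fun x => ⟨?_, ?_⟩,
    fun x => (hac _).2.2.1, ?_⟩
  · have h := HasDerivAt.scomp x (hac (rotationTime V E x)).1 (hV.hasDerivAt_rotationTime hE x)
    refine h.congr_deriv ?_
    simp only [hp.apply_rotationTime hV hE, scatteringDensity, rotationPhase, Function.comp,
      Complex.real_smul]
    push_cast
    ring
  · have h := HasDerivAt.scomp x (hac (rotationTime V E x)).2.1 (hV.hasDerivAt_rotationTime hE x)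
    refine h.congr_deriv ?_
    simp only [hp.apply_rotationTime hV hE, scatteringDensity, rotationPhase, Function.comp,
      Complex.real_smul, ← Complex.exp_neg]
    push_cast
    ring
  · have h1 : rotationTime V E π = t₀ + T := by
      have := hV.rotationTime_pi_sub hE
      simp only [t₀, hT]; linarith
    rw [← htrace, ← h1, (hac _).2.2.2]
    have h2 : ((rotationTime V E π : ℝ) : ℂ) - t₀ = T := by rw [h1]; push_cast; ring
    rw [h2]; rfl

/-! ### The scattering limit -/

/-- Grönwall estimate with an inhomogeneity that is small only in `L¹`. -/
theorem norm_le_of_hasDerivAt_add {E : Type*} [NormedAddCommGroup E] [NormedSpace ℝ E]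
    [CompleteSpace E] {D f r : ℝ → E} {a b K ε : ℝ} (hab : a ≤ b) (hK : 0 < K)
    (hD : ∀ x, HasDerivAt D (f x + r x) x) (hf : ∀ x ∈ Icc a b, ‖f x‖ ≤ K * ‖D x‖)
    (hr : Continuous r) (hε : ∫ x in a..b, ‖r x‖ ≤ ε) (hDa : D a = 0) :
    ‖D b‖ ≤ ε * Real.exp (K * (b - a)) := by
  set R : ℝ → E := fun x => ∫ y in a..x, r y with hR
  have hRd : ∀ x, HasDerivAt R (r x) x := fun x =>
    intervalIntegral.integral_hasDerivAt_right (hr.intervalIntegrable _ _)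
      (hr.stronglyMeasurableAtFilter _ _) hr.continuousAt
  have hRn : ∀ x ∈ Icc a b, ‖R x‖ ≤ ε := by
    intro x hx
    refine (intervalIntegral.norm_integral_le_integral_norm hx.1).trans (le_trans ?_ hε)
    exact intervalIntegral.integral_mono_interval le_rfl hx.1 hx.2
      (Eventually.of_forall fun y => norm_nonneg _) (hr.norm.intervalIntegrable _ _)
  -- removing the primitive of `r` turns the inhomogeneity into a bounded one
  have hUd : ∀ x, HasDerivAt (fun x => D x - R x) (f x) x := fun x =>
    ((hD x).sub (hRd x)).congr_deriv (by abel)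
  have hU := norm_le_gronwallBound_of_norm_deriv_right_le (f := fun x => D x - R x) (f' := f)
    (δ := 0) (K := K) (ε := K * ε) (a := a) (b := b)
    (fun x _ => (hUd x).continuousAt.continuousWithinAt) (fun x _ => (hUd x).hasDerivWithinAt)
    (by simp [hR, hDa]) (fun x hx => by
      have hx' := Ico_subset_Icc_self hx
      refine (hf x hx').trans ?_
      rw [← mul_add]
      refine mul_le_mul_of_nonneg_left ?_ hK.le
      calc ‖D x‖ = ‖(D x - R x) + R x‖ := by rw [sub_add_cancel]
        _ ≤ _ := norm_add_le _ _
        _ ≤ _ := by linarith [hRn x hx']) b ⟨hab, le_rfl⟩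
  rw [gronwallBound_of_K_ne_0 hK.ne', mul_div_cancel_left₀ _ hK.ne'] at hU
  calc ‖D b‖ = ‖(D b - R b) + R b‖ := by rw [sub_add_cancel]
    _ ≤ _ := norm_add_le _ _
    _ ≤ _ := by linarith [hRn b ⟨hab, le_rfl⟩]

namespace IsAmplitudeSolution

variable {s s' : ℝ → ℝ} {e e' a c a' c' : ℝ → ℂ} {l u S : ℝ}

theorem norm_mul_add_le {k p q z w : ℂ} {S : ℝ} (hk : ‖k‖ ≤ S) (hp : ‖p‖ ≤ 1) {N : ℝ}
    (hz : ‖z‖ ≤ N) (hw : ‖w‖ ≤ N) (hq : q = k * (z + p * w)) : ‖q‖ ≤ 2 * S * N := by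
  have hS : 0 ≤ S := (norm_nonneg _).trans hk
  have hN : 0 ≤ N := (norm_nonneg _).trans hz
  have h1 : ‖z + p * w‖ ≤ 2 * N := by
    refine (norm_add_le _ _).trans ?_
    rw [norm_mul]
    nlinarith [norm_nonneg w, norm_nonneg p]
  rw [hq, norm_mul]
  calc ‖k‖ * ‖z + p * w‖ ≤ S * (2 * N) := mul_le_mul hk h1 (norm_nonneg _) hS
    _ = _ := by ring

/-- A priori bound, uniform over all densities bounded by `S`. -/
theorem norm_le (h : IsAmplitudeSolution s e a c) (he : ∀ x, ‖e x‖ = 1)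
    (hs : ∀ x ∈ Icc l u, |s x| ≤ S) (ha : a l = 1) (hc : c l = 0) {x : ℝ} (hx : x ∈ Icc l u)
    (hS : 0 ≤ S) :
    ‖a x‖ ≤ Real.exp (2 * S * (u - l)) ∧ ‖c x‖ ≤ Real.exp (2 * S * (u - l)) := by
  have hd : ∀ x, HasDerivAt (fun x => (a x, c x)) (-(Complex.I * ↑(s x)) * (a x + e x * c x),
      (Complex.I * ↑(s x)) * (c x + (e x)⁻¹ * a x)) x := fun x => (h x).1.prodMk (h x).2
  have := norm_le_gronwallBound_of_norm_deriv_right_le (δ := 1) (K := 2 * S) (ε := 0)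
    (fun x _ => (hd x).continuousAt.continuousWithinAt) (fun x _ => (hd x).hasDerivWithinAt)
    (by simp [ha, hc]) (fun x hx => by
      have hk : ‖Complex.I * ↑(s x)‖ ≤ S := by
        simpa using hs x (Ico_subset_Icc_self hx)
      rw [add_zero]
      refine norm_prod_le_iff.2 ⟨?_, ?_⟩
      · exact norm_mul_add_le (by rwa [norm_neg]) (he x).le (norm_fst_le (a x, c x))
          (norm_snd_le (a x, c x)) rfl
      · exact norm_mul_add_le hk (by rw [norm_inv, he x, inv_one]) (norm_snd_le (a x, c x))
          (norm_fst_le (a x, c x)) rfl) x hx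
  rw [gronwallBound_ε0, one_mul] at this
  have h2 : Real.exp (2 * S * (x - l)) ≤ Real.exp (2 * S * (u - l)) :=
    Real.exp_le_exp.2 (mul_le_mul_of_nonneg_left (by linarith [hx.2]) (by positivity))
  exact norm_prod_le_iff.1 (this.trans h2)

/-- The amplitudes depend continuously on the coefficients in the `L¹` sense. -/
theorem norm_sub_le (h : IsAmplitudeSolution s e a c) (h' : IsAmplitudeSolution s' e' a' c')
    (he : ∀ x, ‖e x‖ = 1) (he' : ∀ x, ‖e' x‖ = 1) (hsc : Continuous s) (hsc' : Continuous s')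
    (hec : Continuous e) (hec' : Continuous e')
    (hS : 0 < S) (hs : ∀ x ∈ Icc l u, |s x| ≤ S) (hs' : ∀ x ∈ Icc l u, |s' x| ≤ S)
    (ha : a l = 1) (hc : c l = 0) (ha' : a' l = 1) (hc' : c' l = 0) (hlu : l ≤ u) :
    ‖a u - a' u‖ ≤ Real.exp (2 * S * (u - l)) ^ 2 *
      ∫ x in l..u, (|s x - s' x| + ‖s x * e x - s' x * e' x‖) := by
  set B := Real.exp (2 * S * (u - l)) with hB
  have hB0 : 0 < B := Real.exp_pos _
  have hac' : Continuous a' := continuous_iff_continuousAt.2 fun x => (h' x).1.continuousAt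
  have hcc' : Continuous c' := continuous_iff_continuousAt.2 fun x => (h' x).2.continuousAt
  have hne : ∀ x, e x ≠ 0 := fun x h0 => by simpa [h0] using he x
  have hne' : ∀ x, e' x ≠ 0 := fun x h0 => by simpa [h0] using he' x
  set f : ℝ → ℂ × ℂ := fun x =>
    (-(Complex.I * ↑(s x)) * ((a x - a' x) + e x * (c x - c' x)),
      (Complex.I * ↑(s x)) * ((c x - c' x) + (e x)⁻¹ * (a x - a' x)))
  set r : ℝ → ℂ × ℂ := fun x =>
    (-(Complex.I * ((s x - s' x) * a' x + (s x * e x - s' x * e' x) * c' x)),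
      Complex.I * ((s x - s' x) * c' x + (s x * (e x)⁻¹ - s' x * (e' x)⁻¹) * a' x))
  have hr : Continuous r := by
    have := hec.inv₀ hne
    have := hec'.inv₀ hne'
    have := Complex.continuous_ofReal.comp hsc
    have := Complex.continuous_ofReal.comp hsc'
    simp only [Function.comp_def] at *
    refine Continuous.prodMk ?_ ?_ <;> fun_prop
  have hD : ∀ x, HasDerivAt (fun x => (a x - a' x, c x - c' x)) (f x + r x) x := fun x =>
    (((h x).1.sub (h' x).1).prodMk ((h x).2.sub (h' x).2)).congr_deriv (by
      simp only [f, r, Prod.mk_add_mk]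
      refine Prod.ext ?_ ?_ <;> simp only <;> ring)
  have hf : ∀ x ∈ Icc l u, ‖f x‖ ≤ 2 * S * ‖(a x - a' x, c x - c' x)‖ := by
    intro x hx
    have hk : ‖Complex.I * ↑(s x)‖ ≤ S := by simpa using hs x hx
    refine norm_prod_le_iff.2 ⟨?_, ?_⟩
    · exact norm_mul_add_le (by rwa [norm_neg]) (he x).le
        (norm_fst_le (a x - a' x, c x - c' x)) (norm_snd_le (a x - a' x, c x - c' x)) rfl
    · exact norm_mul_add_le hk (by rw [norm_inv, he x, inv_one])
        (norm_snd_le (a x - a' x, c x - c' x)) (norm_fst_le (a x - a' x, c x - c' x)) rfl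
  have hconj : ∀ x, ‖(s x : ℂ) * (e x)⁻¹ - s' x * (e' x)⁻¹‖ = ‖s x * e x - s' x * e' x‖ := by
    intro x
    rw [Complex.inv_eq_conj (he x), Complex.inv_eq_conj (he' x), ← Complex.norm_conj]
    simp
  have hrn : ∀ x ∈ Icc l u, ‖r x‖ ≤ B * (|s x - s' x| + ‖s x * e x - s' x * e' x‖) := by
    intro x hx
    obtain ⟨h1, h2⟩ := h'.norm_le he' hs' ha' hc' hx hS.le
    have hn : ‖(s x : ℂ) - s' x‖ = |s x - s' x| := by
      rw [← Complex.ofReal_sub, Complex.norm_real, Real.norm_eq_abs]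
    have h3 : ∀ z w k : ℂ, ‖z‖ ≤ B → ‖w‖ ≤ B → ‖k‖ = ‖s x * e x - s' x * e' x‖ →
        ‖((s x : ℂ) - s' x) * z + k * w‖ ≤ B * (|s x - s' x| + ‖s x * e x - s' x * e' x‖) := by
      intro z w k hz hw hk
      refine (norm_add_le _ _).trans ?_
      rw [norm_mul, norm_mul, hn, hk, mul_add]
      refine add_le_add ?_ ?_
      · rw [mul_comm B]; exact mul_le_mul_of_nonneg_left hz (abs_nonneg _)
      · rw [mul_comm B]; exact mul_le_mul_of_nonneg_left hw (norm_nonneg _)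
    refine norm_prod_le_iff.2 ⟨?_, ?_⟩
    · simp only [r, norm_neg, norm_mul, Complex.norm_I, one_mul]
      exact h3 _ _ _ h1 h2 rfl
    · simp only [r, norm_mul, Complex.norm_I, one_mul]
      exact h3 _ _ _ h2 h1 (hconj x)
  have hcont : Continuous fun x => |s x - s' x| + ‖s x * e x - s' x * e' x‖ := by
    have := Complex.continuous_ofReal.comp hsc
    have := Complex.continuous_ofReal.comp hsc'
    simp only [Function.comp_def] at *
    fun_prop
  have hI : ∫ x in l..u, ‖r x‖ ≤
      B * ∫ x in l..u, (|s x - s' x| + ‖s x * e x - s' x * e' x‖) := by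
    rw [← intervalIntegral.integral_const_mul]
    exact intervalIntegral.integral_mono_on hlu (hr.norm.intervalIntegrable _ _)
      ((continuous_const.mul hcont).intervalIntegrable _ _) hrn
  have := norm_le_of_hasDerivAt_add hlu (by positivity) hD hf hr hI (by simp [ha, ha', hc, hc'])
  refine (norm_fst_le (a u - a' u, c u - c' u)).trans (this.trans (le_of_eq ?_))
  rw [← hB]; ring

end IsAmplitudeSolution

namespace IsAdmissiblePotential

variable {V : ℝ → ℝ}

theorem continuous_scatteringDensity (hV : IsAdmissiblePotential V) (ω : ℝ) {E : ℝ} (hE : 0 < E) :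
    Continuous (scatteringDensity V ω E) :=
  ((hV.continuous_deriv_deriv.sub continuous_const).mul
    (continuous_const.mul (hV.continuous_one_div_sqrt hE))).div_const _

theorem continuous_rotationPhase (hV : IsAdmissiblePotential V) (ω : ℝ) {E : ℝ} (hE : 0 < E) :
    Continuous (rotationPhase V ω E) := by
  have := Complex.continuous_ofReal.comp (hV.continuous_rotationTime hE)
  simp only [Function.comp_def] at this
  unfold rotationPhase
  fun_prop

theorem norm_rotationPhase (V : ℝ → ℝ) (ω E x : ℝ) : ‖rotationPhase V ω E x‖ = 1 := by
  rw [rotationPhase, show 2 * (ω : ℂ) * rotationTime V E x * Complex.I =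
    ↑(2 * ω * rotationTime V E x) * Complex.I by push_cast; ring, Complex.norm_exp_ofReal_mul_I]

/-- The square root in the density is, for every energy, at least a constant times the distance to
the nearest maximum, and the numerator is at most a constant times that distance by the Lipschitz
condition; so the density is bounded uniformly in the energy. -/
theorem exists_abs_scatteringDensity_le (hV : IsAdmissiblePotential V) {ω : ℝ} (hω : 0 < ω) :
    ∃ S, 0 < S ∧ ∀ E, 0 < E → ∀ x ∈ Icc (-π) π, |scatteringDensity V ω E x| ≤ S := by
  obtain ⟨K, hK, hKs⟩ := hV.exists_abs_deriv_deriv_sub_le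
  obtain ⟨c, hc, hcs⟩ := hV.exists_mul_sq_le_neg
  have hsc := Real.sqrt_pos.2 hc
  have h2 : 0 < √(2 : ℝ) := Real.sqrt_pos.2 two_pos
  refine ⟨K / √c * (1 / √2) / (2 * ω), by positivity, fun E hE x hx => ?_⟩
  obtain ⟨s, hs, hVs, hWs⟩ := hV.apply_eq_shift (abs_le.2 hx)
  have hspi : |s| ≤ π := by rw [hs]; linarith [abs_nonneg x]
  have hpos := Real.sqrt_pos.2 (hV.sub_pos hE x)
  have hle : √c * |s| ≤ √(E - V x) := by
    refine Real.le_sqrt_of_sq_le ?_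
    rw [mul_pow, Real.sq_sqrt hc.le, sq_abs, hVs]
    linarith [hcs s hspi]
  have h3 : |deriv (deriv V) x - deriv (deriv V) π| * (1 / √(E - V x)) ≤ K / √c := by
    rw [mul_one_div, div_le_div_iff₀ hpos hsc, hWs]
    calc _ ≤ K * |s| * √c := mul_le_mul_of_nonneg_right (hKs s) hsc.le
      _ = K * (√c * |s|) := by ring
      _ ≤ _ := mul_le_mul_of_nonneg_left hle hK.le
  rw [scatteringDensity, abs_div, abs_of_pos (by positivity : (0 : ℝ) < 2 * ω), abs_mul,
    abs_of_pos (by positivity : 0 < 1 / √2 * (1 / √(E - V x)))]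
  refine div_le_div_of_nonneg_right ?_ (by positivity)
  calc _ = |deriv (deriv V) x - deriv (deriv V) π| * (1 / √(E - V x)) * (1 / √2) := by ring
    _ ≤ _ := mul_le_mul_of_nonneg_right h3 (by positivity)

theorem tendsto_one_div_sqrt (hV : IsAdmissiblePotential V) {x : ℝ} (hx : |x| < π) :
    Tendsto (fun E => 1 / √(E - V x)) (𝓝[>] 0) (𝓝 (1 / √(0 - V x))) := by
  have hneg : V x < 0 := by
    obtain ⟨s, hs, hVs, -⟩ := hV.apply_eq_shift hx.le
    rw [hVs]
    refine hV.neg_of_abs_le (by rw [hs]; linarith [abs_nonneg x]) fun h => ?_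
    rw [h, abs_zero] at hs
    linarith
  have h : ContinuousAt (fun E => 1 / √(E - V x)) 0 :=
    continuousAt_const.div (continuousAt_id.sub continuousAt_const).sqrt
      (Real.sqrt_pos.2 (by simpa using hneg)).ne'
  exact h.tendsto.mono_left nhdsWithin_le_nhds

theorem tendsto_rotationTime (hV : IsAdmissiblePotential V) {x : ℝ} (hx : |x| < π) :
    Tendsto (fun E => rotationTime V E x) (𝓝[>] 0) (𝓝 (rotationTime V 0 x)) := by
  obtain ⟨c, hc, hcs⟩ := hV.exists_mul_sq_le_neg
  have hmem : ∀ y ∈ uIoc 0 x, |y| ≤ |x| := by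
    intro y hy
    rcases le_total 0 x with h | h
    · rw [uIoc_of_le h] at hy
      rw [abs_of_pos hy.1, abs_of_nonneg h]; exact hy.2
    · rw [uIoc_of_ge h] at hy
      rw [abs_of_nonpos hy.2, abs_of_nonpos h]; linarith [hy.1]
  have hd : 0 < π - |x| := by linarith
  refine Tendsto.const_mul _ (intervalIntegral.tendsto_integral_filter_of_dominated_convergence
    (fun _ => 1 / √(c * (π - |x|) ^ 2)) ?_ ?_ intervalIntegrable_const ?_)
  · filter_upwards [self_mem_nhdsWithin] with E hE
    exact (hV.continuous_one_div_sqrt hE).aestronglyMeasurable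
  · filter_upwards [self_mem_nhdsWithin] with E hE
    refine Eventually.of_forall fun y hy => ?_
    have hy' := hmem y hy
    rw [Real.norm_of_nonneg (by positivity)]
    refine one_div_le_one_div_of_le (Real.sqrt_pos.2 (by positivity)) (Real.sqrt_le_sqrt ?_)
    obtain ⟨s, hs, hVs, -⟩ := hV.apply_eq_shift (hy'.trans hx.le)
    have h1 := hcs s (by rw [hs]; linarith [abs_nonneg y])
    rw [← sq_abs, hs] at h1
    have h2 : c * (π - |x|) ^ 2 ≤ c * (π - |y|) ^ 2 :=
      mul_le_mul_of_nonneg_left (pow_le_pow_left₀ hd.le (by linarith) 2) hc.le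
    have hE' : 0 < E := hE
    rw [hVs]
    linarith
  · exact Eventually.of_forall fun y hy => hV.tendsto_one_div_sqrt ((hmem y hy).trans_lt hx)

theorem tendsto_scatteringDensity (hV : IsAdmissiblePotential V) (ω : ℝ) {x : ℝ} (hx : |x| < π) :
    Tendsto (fun E => scatteringDensity V ω E x) (𝓝[>] 0) (𝓝 (scatteringDensity V ω 0 x)) :=
  (((hV.tendsto_one_div_sqrt hx).const_mul _).const_mul _).div_const _

theorem tendsto_rotationPhase (hV : IsAdmissiblePotential V) (ω : ℝ) {x : ℝ} (hx : |x| < π) :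
    Tendsto (fun E => rotationPhase V ω E x) (𝓝[>] 0) (𝓝 (rotationPhase V ω 0 x)) :=
  ((((Complex.continuous_ofReal.tendsto _).comp (hV.tendsto_rotationTime hx)).const_mul _).mul_const
    _).cexp

/-- The coefficients of the amplitude equations are Cauchy in `L¹` as the energy decreases to `0`,
by dominated convergence. -/
theorem tendsto_integral_amplitude_coeff (hV : IsAdmissiblePotential V) {ω : ℝ} (hω : 0 < ω) :
    Tendsto (fun q : ℝ × ℝ => ∫ x in (-π)..π,
      (|scatteringDensity V ω q.1 x - scatteringDensity V ω q.2 x| +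
        ‖scatteringDensity V ω q.1 x * rotationPhase V ω q.1 x -
          scatteringDensity V ω q.2 x * rotationPhase V ω q.2 x‖))
      (𝓝[>] 0 ×ˢ 𝓝[>] 0) (𝓝 0) := by
  obtain ⟨S, hS, hSb⟩ := hV.exists_abs_scatteringDensity_le hω
  have hpos : ∀ᶠ q : ℝ × ℝ in 𝓝[>] 0 ×ˢ 𝓝[>] 0, 0 < q.1 ∧ 0 < q.2 :=
    prod_mem_prod self_mem_nhdsWithin self_mem_nhdsWithin
  have hcont : ∀ E, 0 < E → Continuous fun x =>
      (scatteringDensity V ω E x : ℂ) * rotationPhase V ω E x := fun E hE =>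
    (Complex.continuous_ofReal.comp (hV.continuous_scatteringDensity ω hE)).mul
      (hV.continuous_rotationPhase ω hE)
  have h0 : (0 : ℝ) = ∫ x in (-π)..π, (0 : ℝ) := by simp
  conv => arg 3; rw [h0]
  refine intervalIntegral.tendsto_integral_filter_of_dominated_convergence (fun _ => 4 * S)
    ?_ ?_ intervalIntegrable_const ?_
  · filter_upwards [hpos] with q hq
    exact (((hV.continuous_scatteringDensity ω hq.1).sub
      (hV.continuous_scatteringDensity ω hq.2)).abs.add
      ((hcont _ hq.1).sub (hcont _ hq.2)).norm).aestronglyMeasurable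
  · filter_upwards [hpos] with q hq
    refine Eventually.of_forall fun x hx => ?_
    rw [uIoc_of_le (by linarith [pi_pos])] at hx
    have h1 := hSb _ hq.1 x (Ioc_subset_Icc_self hx)
    have h2 := hSb _ hq.2 x (Ioc_subset_Icc_self hx)
    rw [Real.norm_of_nonneg (by positivity)]
    have h3 := abs_sub (scatteringDensity V ω q.1 x) (scatteringDensity V ω q.2 x)
    have h4 := norm_sub_le ((scatteringDensity V ω q.1 x : ℂ) * rotationPhase V ω q.1 x)
      (scatteringDensity V ω q.2 x * rotationPhase V ω q.2 x)
    simp only [norm_mul, norm_rotationPhase, Complex.norm_real, Real.norm_eq_abs, mul_one] at h4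
    linarith
  · have hne : ∀ᵐ x : ℝ, x ≠ π := MeasureTheory.Measure.ae_ne _ _
    filter_upwards [hne] with x hxne hx
    rw [uIoc_of_le (by linarith [pi_pos])] at hx
    have hx' : |x| < π := abs_lt.2 ⟨hx.1, lt_of_le_of_ne hx.2 hxne⟩
    have h1 := hV.tendsto_scatteringDensity ω hx'
    have h2 := ((Complex.continuous_ofReal.tendsto _).comp h1).mul (hV.tendsto_rotationPhase ω hx')
    have h3 := ((h1.comp tendsto_fst).sub (h1.comp (tendsto_snd (f := 𝓝[>] (0 : ℝ))))).abs.add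
      ((h2.comp tendsto_fst).sub (h2.comp (tendsto_snd (f := 𝓝[>] (0 : ℝ))))).norm
    simpa using h3

/-- Existence of the scattering limit. -/
theorem exists_tendsto_amplitude (hV : IsAdmissiblePotential V) {ω : ℝ} (hω : 0 < ω)
    {a c : ℝ → ℝ → ℂ} (ha : ∀ E, 0 < E → a E (-π) = 1) (hc : ∀ E, 0 < E → c E (-π) = 0)
    (hac : ∀ E, 0 < E → IsAmplitudeSolution (scatteringDensity V ω E) (rotationPhase V ω E)
      (a E) (c E)) :
    ∃ α, Tendsto (fun E => a E π) (𝓝[>] 0) (𝓝 α) := by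
  obtain ⟨S, hS, hSb⟩ := hV.exists_abs_scatteringDensity_le hω
  refine cauchy_map_iff_exists_tendsto.1 (cauchy_map_iff.2 ⟨inferInstance, ?_⟩)
  rw [tendsto_uniformity_iff_dist_tendsto_zero]
  have h := (hV.tendsto_integral_amplitude_coeff hω).const_mul
    (Real.exp (2 * S * (π - -π)) ^ 2)
  rw [mul_zero] at h
  refine squeeze_zero' (Eventually.of_forall fun _ => dist_nonneg) ?_ h
  filter_upwards [prod_mem_prod (self_mem_nhdsWithin (a := (0 : ℝ)) (s := Ioi 0))
    (self_mem_nhdsWithin (a := (0 : ℝ)) (s := Ioi 0))] with q hq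
  obtain ⟨h1, h2⟩ : 0 < q.1 ∧ 0 < q.2 := hq
  rw [dist_eq_norm]
  exact (hac _ h1).norm_sub_le (hac _ h2) (norm_rotationPhase V ω _) (norm_rotationPhase V ω _)
    (hV.continuous_scatteringDensity ω h1) (hV.continuous_scatteringDensity ω h2)
    (hV.continuous_rotationPhase ω h1) (hV.continuous_rotationPhase ω h2) hS (hSb _ h1)
    (hSb _ h2) (ha _ h1) (hc _ h1) (ha _ h2) (hc _ h2) (by linarith [pi_pos])

end IsAdmissiblePotential

/-! ### Asymptotics of the period -/

theorem abs_one_div_sqrt_sub_le {A B : ℝ} (hA : 0 < A) (hB : 0 < B) :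
    |1 / √A - 1 / √B| ≤ |A - B| / (√A * B) := by
  have ha := Real.sqrt_pos.2 hA
  have hb := Real.sqrt_pos.2 hB
  have e : 1 / √A - 1 / √B = (B - A) / (√A * √B * (√A + √B)) := by
    rw [div_sub_div _ _ ha.ne' hb.ne', div_eq_div_iff (by positivity) (by positivity)]
    have h1 := Real.sq_sqrt hA.le
    have h2 := Real.sq_sqrt hB.le
    linear_combination (√A * √B) * h2 - (√A * √B) * h1
  rw [e, abs_div, abs_sub_comm B A, abs_of_pos (by positivity : 0 < √A * √B * (√A + √B))]
  refine div_le_div_of_nonneg_left (abs_nonneg _) (by positivity) ?_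
  have h2 : √B * √B = B := Real.mul_self_sqrt hB.le
  calc √A * B = √A * √B * √B := by rw [mul_assoc, h2]
    _ ≤ _ := mul_le_mul_of_nonneg_left (by linarith) (by positivity)

theorem integral_one_div_sqrt_add_sq {lam b E : ℝ} (hlam : 0 < lam) (hE : 0 < E) :
    ∫ s in (0 : ℝ)..b, 1 / √(2 * E + lam ^ 2 * s ^ 2) =
      1 / lam * (Real.log (lam * b + √(2 * E + lam ^ 2 * b ^ 2)) - Real.log (√(2 * E))) := by
  have hpos : ∀ s : ℝ, 0 < 2 * E + lam ^ 2 * s ^ 2 := fun s => by positivity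
  have hgt : ∀ s : ℝ, 0 < lam * s + √(2 * E + lam ^ 2 * s ^ 2) := by
    intro s
    have h1 : |lam * s| < √(2 * E + lam ^ 2 * s ^ 2) := by
      rw [← Real.sqrt_sq_eq_abs]
      exact Real.sqrt_lt_sqrt (sq_nonneg _) (by rw [mul_pow]; linarith)
    linarith [neg_abs_le (lam * s)]
  have hd : ∀ s ∈ uIcc 0 b, HasDerivAt
      (fun s => 1 / lam * Real.log (lam * s + √(2 * E + lam ^ 2 * s ^ 2)))
      (1 / √(2 * E + lam ^ 2 * s ^ 2)) s := by
    intro s _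
    have h1 : HasDerivAt (fun s : ℝ => 2 * E + lam ^ 2 * s ^ 2) (lam ^ 2 * (2 * s)) s := by
      have := (((hasDerivAt_id s).pow 2).const_mul (lam ^ 2)).const_add (2 * E)
      exact this.congr_deriv (by simp)
    have h2 := ((((hasDerivAt_id s).const_mul lam).add (h1.sqrt (hpos s).ne')).log
      (hgt s).ne').const_mul (1 / lam)
    refine h2.congr_deriv ?_
    have h3 := Real.sqrt_pos.2 (hpos s)
    have h4 := hgt s
    simp only [id, Pi.add_apply] at *
    field_simp
    ring
  have hcont : Continuous fun s : ℝ => 1 / √(2 * E + lam ^ 2 * s ^ 2) :=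
    continuous_const.div (by fun_prop) fun s => (Real.sqrt_pos.2 (hpos s)).ne'
  rw [intervalIntegral.integral_eq_sub_of_hasDerivAt hd (hcont.intervalIntegrable _ _)]
  simp
  ring

/-- Passage time past one side of a nondegenerate maximum at `s = 0`: it is
`-(log E) / (2 lam)` up to a convergent term, by comparison with the quadratic potential. -/
theorem exists_tendsto_passage_time {U : ℝ → ℝ} (hU : Continuous U) {b c K lam : ℝ} (hb : 0 < b)
    (hlam : 0 < lam) (hc : 0 < c) (hcs : ∀ s ∈ Ioc 0 b, c * s ^ 2 ≤ U s)
    (hU0 : ∀ s, 0 ≤ U s) (hK : ∀ s ∈ Ioc 0 b, |lam ^ 2 * s ^ 2 - 2 * U s| ≤ K * s ^ 3) :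
    ∃ L, Tendsto (fun E => (1 / √2 * ∫ s in (0 : ℝ)..b, 1 / √(E + U s)) +
      1 / (2 * lam) * Real.log E) (𝓝[>] 0) (𝓝 L) := by
  have hcontA : ∀ E, 0 < E → Continuous fun s => 1 / √(2 * (E + U s)) := fun E hE =>
    continuous_const.div (by fun_prop) fun s =>
      (Real.sqrt_pos.2 (by linarith [hU0 s])).ne'
  have hcontB : ∀ E, 0 < E → Continuous fun s : ℝ => 1 / √(2 * E + lam ^ 2 * s ^ 2) := fun E hE =>
    continuous_const.div (by fun_prop) fun s => (Real.sqrt_pos.2 (by positivity)).ne'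
  have hDCT : Tendsto (fun E => ∫ s in (0 : ℝ)..b,
      (1 / √(2 * (E + U s)) - 1 / √(2 * E + lam ^ 2 * s ^ 2))) (𝓝[>] 0)
      (𝓝 (∫ s in (0 : ℝ)..b,
        (1 / √(2 * (0 + U s)) - 1 / √(2 * 0 + lam ^ 2 * s ^ 2)))) := by
    refine intervalIntegral.tendsto_integral_filter_of_dominated_convergence
      (fun _ => K / (√(2 * c) * lam ^ 2)) ?_ ?_ intervalIntegrable_const ?_
    · filter_upwards [self_mem_nhdsWithin] with E hE
      exact ((hcontA E hE).sub (hcontB E hE)).aestronglyMeasurable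
    · filter_upwards [self_mem_nhdsWithin] with E hE
      have hE' : 0 < E := hE
      refine Eventually.of_forall fun s hs => ?_
      rw [uIoc_of_le hb.le] at hs
      have hs0 : 0 < s := hs.1
      rw [Real.norm_eq_abs]
      refine (abs_one_div_sqrt_sub_le (by linarith [hU0 s]) (by positivity)).trans ?_
      have h1 : |2 * (E + U s) - (2 * E + lam ^ 2 * s ^ 2)| ≤ K * s ^ 3 := by
        rw [abs_sub_comm]
        refine le_trans (le_of_eq ?_) (hK s hs)
        congr 1; ring
      have h2 : √(2 * c) * s ≤ √(2 * (E + U s)) := by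
        refine Real.le_sqrt_of_sq_le ?_
        rw [mul_pow, Real.sq_sqrt (by positivity)]
        linarith [hcs s hs]
      have h3 : lam ^ 2 * s ^ 2 ≤ 2 * E + lam ^ 2 * s ^ 2 := by linarith
      have h2c := Real.sqrt_pos.2 (show 0 < 2 * c by positivity)
      calc _ ≤ K * s ^ 3 / (√(2 * c) * s * (lam ^ 2 * s ^ 2)) :=
            div_le_div₀ ((abs_nonneg _).trans h1) h1 (by positivity)
              (mul_le_mul h2 h3 (by positivity) (by positivity))
        _ = _ := by field_simp
    · refine Eventually.of_forall fun s hs => ?_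
      rw [uIoc_of_le hb.le] at hs
      have hs0 : 0 < s := hs.1
      have h1 : 0 < U s := lt_of_lt_of_le (by positivity) (hcs s hs)
      have h : ContinuousAt
          (fun E => 1 / √(2 * (E + U s)) - 1 / √(2 * E + lam ^ 2 * s ^ 2)) 0 := by
        refine ContinuousAt.sub (continuousAt_const.div (by fun_prop) ?_)
          (continuousAt_const.div (by fun_prop) ?_)
        · exact (Real.sqrt_pos.2 (by linarith)).ne'
        · exact (Real.sqrt_pos.2 (by positivity)).ne'
      exact h.tendsto.mono_left nhdsWithin_le_nhds
  have hlog : Tendsto (fun E => 1 / lam * (Real.log (lam * b + √(2 * E + lam ^ 2 * b ^ 2)) -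
      Real.log 2 / 2)) (𝓝[>] 0)
      (𝓝 (1 / lam * (Real.log (lam * b + √(2 * 0 + lam ^ 2 * b ^ 2)) - Real.log 2 / 2))) := by
    have h : ContinuousAt (fun E => 1 / lam * (Real.log (lam * b + √(2 * E + lam ^ 2 * b ^ 2)) -
      Real.log 2 / 2)) 0 := by
      refine continuousAt_const.mul ((ContinuousAt.log (by fun_prop) ?_).sub continuousAt_const)
      positivity
    exact h.tendsto.mono_left nhdsWithin_le_nhds
  refine ⟨_, (hDCT.add hlog).congr' ?_⟩
  filter_upwards [self_mem_nhdsWithin] with E hE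
  have hE' : 0 < E := hE
  rw [intervalIntegral.integral_sub ((hcontA E hE).intervalIntegrable _ _)
    ((hcontB E hE).intervalIntegrable _ _), integral_one_div_sqrt_add_sq hlam hE',
    ← intervalIntegral.integral_const_mul]
  have h1 : ∀ s, 1 / √2 * (1 / √(E + U s)) = 1 / √(2 * (E + U s)) := fun s => by
    rw [Real.sqrt_mul zero_le_two, one_div_mul_one_div]
  simp only [h1]
  rw [Real.log_sqrt (by positivity), Real.log_mul two_ne_zero hE'.ne']
  field_simp
  ring

/-- The logarithmic divergence of the period at the separatrix. -/
theorem IsAdmissiblePotential.exists_tendsto_rotationPeriod {V : ℝ → ℝ}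
    (hV : IsAdmissiblePotential V) :
    ∃ L, Tendsto (fun E => rotationPeriod V E +
      1 / √(-(deriv (deriv V) π)) * Real.log E) (𝓝[>] 0) (𝓝 L) := by
  set lam := √(-(deriv (deriv V) π)) with hlamdef
  have hneg : 0 < -(deriv (deriv V) π) := by linarith [hV.nondegenerate]
  have hlam : 0 < lam := Real.sqrt_pos.2 hneg
  have hlam2 : lam ^ 2 = -(deriv (deriv V) π) := Real.sq_sqrt hneg.le
  obtain ⟨K, hK, hKs⟩ := hV.exists_abs_taylor_le
  obtain ⟨c, hc, hcs⟩ := hV.exists_mul_sq_le_neg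
  have hside : ∀ σ : ℝ, |σ| = 1 → ∃ L, Tendsto (fun E => (1 / √2 * ∫ s in (0 : ℝ)..π,
      1 / √(E + -V (π + σ * s))) + 1 / (2 * lam) * Real.log E) (𝓝[>] 0) (𝓝 L) := by
    intro σ hσ
    have hσ2 : σ ^ 2 = 1 := by rw [← sq_abs, hσ, one_pow]
    have habs : ∀ s ∈ Ioc 0 π, |σ * s| = s := fun s hs => by
      rw [abs_mul, hσ, one_mul, abs_of_pos hs.1]
    refine exists_tendsto_passage_time (U := fun s => -V (π + σ * s))
      (hV.continuous.comp (by fun_prop)).neg pi_pos hlam hc (fun s hs => ?_)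
      (fun s => by linarith [hV.nonpos (π + σ * s)]) (K := K) (fun s hs => ?_)
    · have := hcs (σ * s) (by rw [habs s hs]; exact hs.2)
      rwa [mul_pow, hσ2, one_mul] at this
    · have := hKs (σ * s)
      rw [habs s hs, mul_pow, hσ2, one_mul] at this
      rw [hlam2]
      refine le_trans (le_of_eq ?_) this
      congr 1; ring
  obtain ⟨L₁, h1⟩ := hside (-1) (by simp)
  obtain ⟨L₂, h2⟩ := hside 1 (by simp)
  refine ⟨L₂ + L₁, (h2.add h1).congr' ?_⟩
  filter_upwards [self_mem_nhdsWithin] with E hE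
  have hint := fun a b => (hV.continuous_one_div_sqrt hE).intervalIntegrable
    (μ := MeasureTheory.volume) a b
  have e1 : ∫ s in (0 : ℝ)..π, 1 / √(E + -V (π + -1 * s)) = ∫ x in (0 : ℝ)..π, 1 / √(E - V x) := by
    have := intervalIntegral.integral_comp_sub_left (fun x => 1 / √(E - V x)) π (a := 0) (b := π)
    rw [sub_self, sub_zero] at this
    rw [← this]
    simp only [neg_one_mul, ← sub_eq_add_neg]
  have e2 : ∫ s in (0 : ℝ)..π, 1 / √(E + -V (π + 1 * s)) =
      ∫ x in (-π)..0, 1 / √(E - V x) := by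
    have := intervalIntegral.integral_comp_sub_right (fun x => 1 / √(E - V x)) π (a := 0) (b := π)
    rw [sub_self, zero_sub] at this
    rw [← this]
    refine intervalIntegral.integral_congr fun s _ => ?_
    simp only [one_mul]
    rw [← sub_eq_add_neg, ← hV.periodic (s - π)]
    ring_nf
  rw [e1, e2, rotationPeriod, ← intervalIntegral.integral_add_adjacent_intervals (hint (-π) 0)
    (hint 0 π)]
  field_simp
  ring

/-! ### Spectrum and asymptotic formula -/

theorem mem_complexSpectrum_iff {M : Matrix (Fin 2) (Fin 2) ℝ} (hM : M.det = 1) (z : ℂ) :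
    z ∈ complexSpectrum M ↔ z ^ 2 - M.trace * z + 1 = 0 := by
  have hdet : ((M 0 0 : ℂ) * M 1 1 - M 0 1 * M 1 0) = 1 := by
    rw [Matrix.det_fin_two] at hM
    exact_mod_cast hM
  rw [complexSpectrum, spectrum.mem_iff, Matrix.isUnit_iff_isUnit_det, isUnit_iff_ne_zero, not_not,
    Matrix.det_fin_two, Matrix.trace_fin_two]
  have : ((algebraMap ℂ (Matrix (Fin 2) (Fin 2) ℂ)) z - M.map (algebraMap ℝ ℂ)) 0 0 *
      ((algebraMap ℂ (Matrix (Fin 2) (Fin 2) ℂ)) z - M.map (algebraMap ℝ ℂ)) 1 1 -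
      ((algebraMap ℂ (Matrix (Fin 2) (Fin 2) ℂ)) z - M.map (algebraMap ℝ ℂ)) 0 1 *
      ((algebraMap ℂ (Matrix (Fin 2) (Fin 2) ℂ)) z - M.map (algebraMap ℝ ℂ)) 1 0 =
      z ^ 2 - ((M 0 0 + M 1 1 : ℝ) : ℂ) * z + 1 := by
    simp [Matrix.algebraMap_matrix_apply]
    linear_combination hdet
  rw [this]

/-- A root of `z² - t z + 1` is within `√(|t - t'| |z|)` of a root of `z² - t' z + 1`, since the
product of its distances to the two roots is the value `|t - t'| |z|` of the latter polynomial. -/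
theorem exists_root_dist_le {t t' : ℝ} {z : ℂ} (hz : z ^ 2 - t * z + 1 = 0) :
    ∃ w : ℂ, w ^ 2 - t' * w + 1 = 0 ∧ dist z w ≤ √(|t - t'| * (|t| + 1)) := by
  have hzb : ‖z‖ ≤ |t| + 1 := by
    by_contra! h
    have h1 : ‖z‖ ^ 2 ≤ |t| * ‖z‖ + 1 := by
      calc ‖z‖ ^ 2 = ‖(t : ℂ) * z - 1‖ := by
            rw [← norm_pow]; congr 1; linear_combination hz
        _ ≤ ‖(t : ℂ) * z‖ + ‖(1 : ℂ)‖ := norm_sub_le _ _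
        _ = _ := by simp
    nlinarith [abs_nonneg t]
  obtain ⟨d, hd⟩ := IsAlgClosed.exists_pow_nat_eq ((t' : ℂ) ^ 2 - 4) two_pos
  have hprod : ‖z - (t' + d) / 2‖ * ‖z - (t' - d) / 2‖ ≤ |t - t'| * (|t| + 1) := by
    rw [← norm_mul]
    have : (z - (t' + d) / 2) * (z - (t' - d) / 2) = ((t - t' : ℝ) : ℂ) * z := by
      push_cast
      linear_combination hz - hd / 4
    rw [this, norm_mul, Complex.norm_real, Real.norm_eq_abs]
    exact mul_le_mul_of_nonneg_left hzb (abs_nonneg _)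
  rcases le_total ‖z - (t' + d) / 2‖ ‖z - (t' - d) / 2‖ with h | h
  · refine ⟨(t' + d) / 2, by linear_combination hd / 4, ?_⟩
    rw [dist_eq_norm]
    refine Real.le_sqrt_of_sq_le (le_trans ?_ hprod)
    rw [sq]
    exact mul_le_mul_of_nonneg_left h (norm_nonneg _)
  · refine ⟨(t' - d) / 2, by linear_combination hd / 4, ?_⟩
    rw [dist_eq_norm]
    refine Real.le_sqrt_of_sq_le (le_trans ?_ hprod)
    rw [sq]
    exact mul_le_mul_of_nonneg_right h (norm_nonneg _)

theorem hausdorffDist_complexSpectrum_le {M N : Matrix (Fin 2) (Fin 2) ℝ} (hM : M.det = 1)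
    (hN : N.det = 1) {B : ℝ} (hMB : |M.trace| ≤ B) (hNB : |N.trace| ≤ B) :
    Metric.hausdorffDist (complexSpectrum M) (complexSpectrum N) ≤
      √(|M.trace - N.trace| * (B + 1)) := by
  refine Metric.hausdorffDist_le_of_mem_dist (Real.sqrt_nonneg _) (fun z hz => ?_) (fun z hz => ?_)
  · obtain ⟨w, hw, hd⟩ := exists_root_dist_le (t' := N.trace) ((mem_complexSpectrum_iff hM z).1 hz)
    refine ⟨w, (mem_complexSpectrum_iff hN w).2 hw, hd.trans (Real.sqrt_le_sqrt ?_)⟩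
    exact mul_le_mul_of_nonneg_left (by linarith) (abs_nonneg _)
  · obtain ⟨w, hw, hd⟩ := exists_root_dist_le (t' := M.trace) ((mem_complexSpectrum_iff hN z).1 hz)
    refine ⟨w, (mem_complexSpectrum_iff hM w).2 hw, hd.trans (Real.sqrt_le_sqrt ?_)⟩
    rw [abs_sub_comm]
    exact mul_le_mul_of_nonneg_left (by linarith) (abs_nonneg _)

/-- The asymptotic formula for the trace, for any choice of the Floquet matrices. -/
theorem exists_tendsto_trace_sub {V : ℝ → ℝ} (hV : IsAdmissiblePotential V) {κ ω : ℝ} (hω : 0 < ω)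
    (hω2 : ω ^ 2 = 2 * κ + deriv (deriv V) π) {F : ℝ → Matrix (Fin 2) (Fin 2) ℝ}
    (hF : ∀ E, 0 < E → IsFloquetMatrix V κ E (F E)) :
    ∃ a φ : ℝ, 2 ≤ a ∧ Tendsto (fun E : ℝ => (F E).trace -
      a * Real.cos (ω / √(-(deriv (deriv V) π)) * Real.log E - φ)) (𝓝[>] 0) (𝓝 0) := by
  set lam := √(-(deriv (deriv V) π))
  have hex : ∀ E, ∃ a c : ℝ → ℂ, 0 < E → a (-π) = 1 ∧ c (-π) = 0 ∧
      IsAmplitudeSolution (scatteringDensity V ω E) (rotationPhase V ω E) a c ∧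
      (∀ x, ‖a x‖ ^ 2 = 1 + ‖c x‖ ^ 2) ∧
      (F E).trace = 2 * (Complex.exp (-(ω * rotationPeriod V E * Complex.I)) * a π).re := by
    intro E
    by_cases hE : 0 < E
    · obtain ⟨-, a, c, h⟩ := exists_amplitudes hV hω hω2 hE (hF E hE)
      exact ⟨a, c, fun _ => h⟩
    · exact ⟨0, 0, fun h => absurd h hE⟩
  choose a c hac using hex
  obtain ⟨α, hα⟩ := hV.exists_tendsto_amplitude hω (fun E hE => (hac E hE).1)
    (fun E hE => (hac E hE).2.1) (fun E hE => (hac E hE).2.2.1)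
  obtain ⟨L, hL⟩ := hV.exists_tendsto_rotationPeriod
  have hexp : ∀ θ : ℝ, ‖Complex.exp (-(θ * Complex.I))‖ = 1 := fun θ => by
    rw [show -((θ : ℂ) * Complex.I) = ↑(-θ) * Complex.I by push_cast; ring,
      Complex.norm_exp_ofReal_mul_I]
  -- the amplitude of the cosine is at least `2` because `‖a‖² = 1 + ‖c‖²`
  have hα1 : 1 ≤ ‖α‖ := by
    refine ge_of_tendsto hα.norm ?_
    filter_upwards [self_mem_nhdsWithin] with E hE
    have := (hac E hE).2.2.2.1 π
    nlinarith [norm_nonneg (a E π), sq_nonneg ‖c E π‖]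
  set b : ℝ → ℂ := fun E => Complex.exp (-(↑(ω * (rotationPeriod V E + 1 / lam * Real.log E)) *
    Complex.I)) * a E π with hb
  set β : ℂ := Complex.exp (-(↑(ω * L) * Complex.I)) * α with hβ
  have hbβ : Tendsto b (𝓝[>] 0) (𝓝 β) :=
    ((((Complex.continuous_ofReal.tendsto _).comp (hL.const_mul ω)).mul_const
      Complex.I).neg.cexp).mul hα
  have hβn : ‖β‖ = ‖α‖ := by rw [hβ, norm_mul, hexp, one_mul]
  refine ⟨2 * ‖β‖, -Complex.arg β, by linarith, ?_⟩
  have h0 : Tendsto (fun E => 2 * ‖b E - β‖) (𝓝[>] 0) (𝓝 0) := by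
    have := (hbβ.sub_const β).norm.const_mul 2
    simpa using this
  refine squeeze_zero_norm' ?_ h0
  filter_upwards [self_mem_nhdsWithin] with E hE
  set θ : ℝ := ω / lam * Real.log E with hθ
  have h1 : Complex.exp (-(ω * rotationPeriod V E * Complex.I)) * a E π =
      Complex.exp (θ * Complex.I) * b E := by
    rw [hb, ← mul_assoc, ← Complex.exp_add]
    congr 2
    rw [hθ]
    push_cast
    ring
  have h2 : (Complex.exp (θ * Complex.I) * β).re = ‖β‖ * Real.cos (θ - -Complex.arg β) := by
    conv_lhs => rw [← Complex.norm_mul_exp_arg_mul_I β]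
    rw [mul_left_comm, ← Complex.exp_add, ← add_mul, ← Complex.ofReal_add, Complex.re_ofReal_mul,
      Complex.exp_ofReal_mul_I_re, sub_neg_eq_add]
  rw [(hac E hE).2.2.2.2, h1, mul_assoc, ← h2, ← mul_sub, ← Complex.sub_re, ← mul_sub, norm_mul,
    Real.norm_of_nonneg zero_le_two, Real.norm_eq_abs]
  refine mul_le_mul_of_nonneg_left ((Complex.abs_re_le_norm _).trans (le_of_eq ?_)) zero_le_two
  rw [norm_mul, Complex.norm_exp_ofReal_mul_I, one_mul]

theorem mainTheorem2 (V : ℝ → ℝ) (hV : IsAdmissiblePotential V) (κ lam ω : ℝ)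
    (hlam : lam = √(-(deriv (deriv V) π)))
    (hω : 0 < ω) (hω2 : ω ^ 2 = 2 * κ + deriv (deriv V) π) :
    (∀ E : ℝ, 0 < E → ∃! M : Matrix (Fin 2) (Fin 2) ℝ, IsFloquetMatrix V κ E M) ∧
    ∃ a φ : ℝ, 2 ≤ a ∧
      ∀ F : ℝ → Matrix (Fin 2) (Fin 2) ℝ, (∀ E : ℝ, 0 < E → IsFloquetMatrix V κ E (F E)) →
        Tendsto (fun E : ℝ => (F E).trace - a * Real.cos (ω / lam * Real.log E - φ))
          (𝓝[>] 0) (𝓝 0) ∧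
        Tendsto (fun E : ℝ => Metric.hausdorffDist (complexSpectrum (F E))
            (complexSpectrum (F (Real.exp (2 * π * lam / ω) * E))))
          (𝓝[>] 0) (𝓝 0) := by
  have hlam0 : 0 < lam := by
    rw [hlam]; exact Real.sqrt_pos.2 (by linarith [hV.nondegenerate])
  have huniq := fun E (hE : 0 < E) => existsUnique_isFloquetMatrix hV κ hE
  refine ⟨huniq, ?_⟩
  have hex : ∀ E, ∃ M, 0 < E → IsFloquetMatrix V κ E M := fun E => by
    by_cases hE : 0 < E
    · exact ⟨_, fun _ => (huniq E hE).exists.choose_spec⟩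
    · exact ⟨0, fun h => absurd h hE⟩
  choose F₀ hF₀ using hex
  obtain ⟨a, φ, ha, hlim⟩ := exists_tendsto_trace_sub hV hω hω2 hF₀
  rw [← hlam] at hlim
  refine ⟨a, φ, ha, fun F hF => ?_⟩
  have htr : Tendsto (fun E : ℝ => (F E).trace - a * Real.cos (ω / lam * Real.log E - φ))
      (𝓝[>] 0) (𝓝 0) := by
    refine hlim.congr' ?_
    filter_upwards [self_mem_nhdsWithin] with E hE
    rw [(huniq E hE).unique (hF₀ E hE) (hF E hE)]
  refine ⟨htr, ?_⟩
  set k := Real.exp (2 * π * lam / ω) with hk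
  have hk0 : 0 < k := Real.exp_pos _
  have hscale : Tendsto (fun E : ℝ => k * E) (𝓝[>] 0) (𝓝[>] 0) := by
    refine tendsto_nhdsWithin_iff.2 ⟨?_, ?_⟩
    · have : Tendsto (fun E : ℝ => k * E) (𝓝 0) (𝓝 (k * 0)) := tendsto_id.const_mul k
      rw [mul_zero] at this
      exact this.mono_left nhdsWithin_le_nhds
    · filter_upwards [self_mem_nhdsWithin] with E hE
      exact mul_pos hk0 hE
  have htr' := htr.comp hscale
  have hdiff : Tendsto (fun E => |(F E).trace - (F (k * E)).trace|) (𝓝[>] 0) (𝓝 0) := by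
    have := (htr.sub htr').abs
    rw [sub_zero, abs_zero] at this
    refine this.congr' ?_
    filter_upwards [self_mem_nhdsWithin] with E hE
    have hE' : E ≠ 0 := (show 0 < E from hE).ne'
    -- the phase advances by a full turn when the energy is multiplied by `k`
    have h1 : ω / lam * Real.log (k * E) - φ = ω / lam * Real.log E - φ + 2 * π := by
      rw [Real.log_mul hk0.ne' hE', hk, Real.log_exp]
      field_simp
      ring
    simp only [Function.comp, h1, Real.cos_add_two_pi]
    congr 1
    ring
  have hbound : ∀ᶠ E in 𝓝[>] (0 : ℝ), |(F E).trace| ≤ a + 1 := by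
    filter_upwards [(Metric.tendsto_nhds.1 htr) 1 one_pos] with E hE
    rw [Real.dist_eq, sub_zero] at hE
    set x := ω / lam * Real.log E - φ
    have h1 : |a * Real.cos x| ≤ a := by
      rw [abs_mul, abs_of_nonneg (by linarith : 0 ≤ a)]
      exact mul_le_of_le_one_right (by linarith) (Real.abs_cos_le_one _)
    have h2 := abs_add_le ((F E).trace - a * Real.cos x) (a * Real.cos x)
    rw [sub_add_cancel] at h2
    linarith
  have hsqrt : Tendsto (fun E => √(|(F E).trace - (F (k * E)).trace| * (a + 1 + 1))) (𝓝[>] 0)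
      (𝓝 0) := by
    have := (hdiff.mul_const (a + 1 + 1)).sqrt
    simpa using this
  refine squeeze_zero' (Eventually.of_forall fun _ => Metric.hausdorffDist_nonneg) ?_ hsqrt
  filter_upwards [self_mem_nhdsWithin, hbound, hscale.eventually hbound] with E hE h1 h2
  exact hausdorffDist_complexSpectrum_le (exists_amplitudes hV hω hω2 hE (hF E hE)).1
    (exists_amplitudes hV hω hω2 (mul_pos hk0 hE) (hF _ (mul_pos hk0 hE))).1 h1 h2
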